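/- Fix $n\ge 0$ and a Floquet code on $n$ qubits: a non-empty finite schedule $O_1,\dots,O_k$, repeated forever, in which each operation is a measurement of a Pauli string or a Clifford unitary on the $n$ qubits. Fix $t\ge 0$ and an outcome $\pm1$ for each measurement. Let $C_t$ be the linear map on $n$ qubits obtained by composing the first $t$ operations, where a measurement of the Pauli string $P$ with outcome $\pm1$ contributes the projector $\frac12(1\pm P)$, and assume that $C_t\neq 0$. The instantaneous stabiliser group $S_t$ is the group of all (signed) Pauli operators $s$ with $s\,C_t=C_t$. Let $N(S_t)$ be its normaliser in the Pauli group $\{i^kP_1\otimes\dots\otimes P_n\}$. Let $\mathcal D$ be any Clifford ZX diagram with $n$ inputs and $n$ outputs (a finite graph of Z spiders, X spiders with phases in $\frac{\pi}{2}\mathbb Z/2\pi\mathbb Z$, two-legged Hadamard nodes, and one-legged boundary nodes; parallel edges and self-loops are allowed) that represents $C_t$ up to a non-zero scalar. A Pauli web on $\mathcal D$ is a set $w$ of pairs of an edge and a colour in $\{Z,X\}$ (we say that the edge is highlighted in that colour) such that - at a spider with phase in $\{0,\pi\}$, an even number of legs is highlighted in the spider's own colour, and either all or none of its legs are highlighted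 in the opposite colour; - at a spider with phase $\pm\frac{\pi}{2}$, either an even number of legs is highlighted in its own colour and none in the opposite colour, or an odd number of legs is highlighted in its own colour and all in the opposite colour; - at a Hadamard node, one leg is highlighted in $Z$ if and only if the other leg is highlighted in $X$, and vice versa. Let $P$ be the set of all Pauli webs, $S$ the set of those that highlight no input edge (stabilising webs), $S_c$ the set of those that highlight no output edge (co-stabilising webs), and $D=S\cap S_c$ the set of those that highlight no boundary edge (detecting regions). Let $\mathrm{out}(w)$ be the Pauli string read off the output edges, with $Y$ where both colours are highlighted. Webs are multiplied by symmetric difference $\Delta$, and for sets of webs $G,N$ with $g\,\Delta\, n\in G$ for all $g\in G$, $n\in N$ we write $G/N=\{\{g\,\Delta\, n: n\in N\}: g\in G\}$. Let $S\,\Delta\, S_c=\{s\,\Delta\, c: s\in S,\ c\in S_c\}$. Then: 1. There is a bijection $b\colon S/D\to S_t$ such that $b(A)=\pm\,\mathrm{out}(w)$ for every class $A\in S/D$ and every $w\in A$. 2. For every Pauli web $w$, $\mathrm{out}(w)\in N(S_t)$, and there is a bijection from $P/(S\,\Delta\, S_c)$ to $N(S_t)/S_t$, with the global phases $\{1,i,-1,-i\}$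 divided out as well, that sends each class $A$ to the class of $\mathrm{out}(w)$ for every $w\in A$. -/

import Mathlib

/-! Clifford ZX diagrams, Pauli webs, Floquet codes and their instantaneous stabiliser groups.
The computational basis of `n` qubits is indexed by `Fin n → Fin 2`. -/

open scoped symmDiff

noncomputable section

namespace FloquetWebs

/-! ### Pauli operators -/

/-- The four one-qubit Pauli letters. -/
inductive Pauli where
  | I | X | Y | Z

/-- The matrix of a one-qubit Pauli. -/
def Pauli.toMatrix : Pauli → Matrix (Fin 2) (Fin 2) ℂ
  | .I => 1
  | .X => !![0, 1; 1, 0]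
  | .Y => !![0, -Complex.I; Complex.I, 0]
  | .Z => !![1, 0; 0, -1]

/-- An (unsigned) Pauli string on `n` qubits. -/
abbrev PauliString (n : ℕ) := Fin n → Pauli

/-- The operator `P₁ ⊗ ⋯ ⊗ Pₙ` of a Pauli string. -/
def pauliMatrix {n : ℕ} (P : PauliString n) : Matrix (Fin n → Fin 2) (Fin n → Fin 2) ℂ :=
  fun y x => ∏ i, (P i).toMatrix (y i) (x i)

/-- The unitary operators on `n` qubits. -/
abbrev QubitUnitary (n : ℕ) := Matrix.unitaryGroup (Fin n → Fin 2) ℂ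

theorem pauli_mul (a b : Pauli) :
    ∃ (k : ℕ) (c : Pauli), a.toMatrix * b.toMatrix = Complex.I ^ k • c.toMatrix := by
  cases a <;> cases b
  · exact ⟨0, .I, by simp [Pauli.toMatrix]⟩
  · exact ⟨0, .X, by simp [Pauli.toMatrix]⟩
  · exact ⟨0, .Y, by simp [Pauli.toMatrix]⟩
  · exact ⟨0, .Z, by simp [Pauli.toMatrix]⟩
  · exact ⟨0, .X, by simp [Pauli.toMatrix]⟩
  · exact ⟨0, .I, by simp [Pauli.toMatrix, Matrix.one_fin_two]⟩
  · exact ⟨1, .Z, by simp [Pauli.toMatrix]⟩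
  · exact ⟨3, .Y, by simp [Pauli.toMatrix, Complex.I_pow_three]⟩
  · exact ⟨0, .Y, by simp [Pauli.toMatrix]⟩
  · exact ⟨3, .Z, by simp [Pauli.toMatrix, Complex.I_pow_three]⟩
  · exact ⟨0, .I, by simp [Pauli.toMatrix, Matrix.one_fin_two]⟩
  · exact ⟨1, .X, by simp [Pauli.toMatrix]⟩
  · exact ⟨0, .Z, by simp [Pauli.toMatrix]⟩
  · exact ⟨1, .Y, by simp [Pauli.toMatrix]⟩
  · exact ⟨3, .X, by simp [Pauli.toMatrix, Complex.I_pow_three]⟩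
  · exact ⟨0, .I, by simp [Pauli.toMatrix, Matrix.one_fin_two]⟩

theorem pauli_sq (a : Pauli) : a.toMatrix * a.toMatrix = 1 := by
  cases a <;> simp [Pauli.toMatrix, Matrix.one_fin_two]

theorem pauli_star (a : Pauli) (i j : Fin 2) : star (a.toMatrix j i) = a.toMatrix i j := by
  cases a <;> fin_cases i <;> fin_cases j <;> simp [Pauli.toMatrix]

theorem pauliMatrix_mul_apply {n : ℕ} (P Q : PauliString n) (y x : Fin n → Fin 2) :
    (pauliMatrix P * pauliMatrix Q) y x =
      ∏ i, ((P i).toMatrix * (Q i).toMatrix) (y i) (x i) := by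
  simp only [Matrix.mul_apply, pauliMatrix, ← Finset.prod_mul_distrib]
  rw [Finset.prod_univ_sum]
  simp

theorem pauliMatrix_mul {n : ℕ} (P Q : PauliString n) :
    ∃ (k : ℕ) (R : PauliString n),
      pauliMatrix P * pauliMatrix Q = Complex.I ^ k • pauliMatrix R := by
  choose k R h using fun i => pauli_mul (P i) (Q i)
  refine ⟨∑ i, k i, R, ?_⟩
  ext y x
  rw [pauliMatrix_mul_apply]
  simp [h, pauliMatrix, Finset.prod_mul_distrib, Finset.prod_pow_eq_pow_sum]

theorem pauliMatrix_sq {n : ℕ} (P : PauliString n) : pauliMatrix P * pauliMatrix P = 1 := by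
  ext y x
  rw [pauliMatrix_mul_apply]
  simp only [pauli_sq, Matrix.one_apply]
  by_cases h : y = x
  · simp [h]
  · rw [if_neg h]
    obtain ⟨i, hi⟩ := Function.ne_iff.mp h
    exact Finset.prod_eq_zero (Finset.mem_univ i) (if_neg hi)

theorem pauliMatrix_star {n : ℕ} (P : PauliString n) : star (pauliMatrix P) = pauliMatrix P := by
  ext y x
  simp [pauliMatrix, Matrix.star_apply, ← pauli_star (P _) (y _) (x _)]

theorem pauliMatrix_one {n : ℕ} : pauliMatrix (fun _ : Fin n => Pauli.I) = 1 := by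
  rw [← pauliMatrix_sq (fun _ : Fin n => Pauli.I)]
  ext y x
  rw [pauliMatrix_mul_apply]
  simp [pauliMatrix, Pauli.toMatrix]

/-- A Pauli string as a unitary operator. -/
def pauliUnitary {n : ℕ} (P : PauliString n) : QubitUnitary n :=
  ⟨pauliMatrix P, by rw [Matrix.mem_unitaryGroup_iff, pauliMatrix_star, pauliMatrix_sq]⟩

/-- The `n`-qubit Pauli group `{iᵏ P₁ ⊗ ⋯ ⊗ Pₙ}`. -/
def pauliGroup (n : ℕ) : Subgroup (QubitUnitary n) where
  carrier := {U | ∃ (k : ℕ) (P : PauliString n),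
    (U : Matrix (Fin n → Fin 2) (Fin n → Fin 2) ℂ) = Complex.I ^ k • pauliMatrix P}
  one_mem' := ⟨0, fun _ => .I, by simp [pauliMatrix_one]⟩
  mul_mem' := by
    rintro U V ⟨k, P, hU⟩ ⟨l, Q, hV⟩
    obtain ⟨m, R, h⟩ := pauliMatrix_mul P Q
    refine ⟨k + l + m, R, ?_⟩
    simp only [Submonoid.coe_mul, hU, hV, Matrix.smul_mul, Matrix.mul_smul, h, smul_smul]
    ring_nf
  inv_mem' := by
    rintro U ⟨k, P, hU⟩
    refine ⟨3 * k, P, ?_⟩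
    rw [Matrix.UnitaryGroup.inv_val, hU, star_smul, pauliMatrix_star, pow_mul,
      Complex.I_pow_three]
    simp

/-- The global phases `{1, i, -1, -i}`. -/
def phaseGroup (n : ℕ) : Subgroup (QubitUnitary n) where
  carrier := {U | ∃ k : ℕ,
    (U : Matrix (Fin n → Fin 2) (Fin n → Fin 2) ℂ) = Complex.I ^ k • 1}
  one_mem' := ⟨0, by simp⟩
  mul_mem' := by
    rintro U V ⟨k, hU⟩ ⟨l, hV⟩
    refine ⟨k + l, ?_⟩
    simp only [Submonoid.coe_mul, hU, hV, Matrix.smul_mul, Matrix.mul_smul, smul_smul, one_mul]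
    ring_nf
  inv_mem' := by
    rintro U ⟨k, hU⟩
    refine ⟨3 * k, ?_⟩
    rw [Matrix.UnitaryGroup.inv_val, hU, star_smul, star_one, pow_mul, Complex.I_pow_three]
    simp

/-- The Clifford group: the unitaries that normalise the Pauli group. -/
def cliffordGroup (n : ℕ) : Subgroup (QubitUnitary n) :=
  Subgroup.normalizer (pauliGroup n)

/-- The (signed) Pauli operators `s` that stabilise the map `M`, i.e. `s ∘ M = M`. -/
def stabiliserGroup {n : ℕ} (M : Matrix (Fin n → Fin 2) (Fin n → Fin 2) ℂ) :
    Subgroup (QubitUnitary n) where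
  carrier := {s | s ∈ pauliGroup n ∧
    (s : Matrix (Fin n → Fin 2) (Fin n → Fin 2) ℂ) * M = M}
  one_mem' := ⟨one_mem _, by simp⟩
  mul_mem' := by
    rintro U V ⟨hU, hU'⟩ ⟨hV, hV'⟩
    refine ⟨mul_mem hU hV, ?_⟩
    rw [Submonoid.coe_mul, Matrix.mul_assoc, hV', hU']
  inv_mem' := by
    rintro U ⟨hU, hU'⟩
    refine ⟨inv_mem hU, ?_⟩
    conv_lhs => rw [← hU']
    rw [← Matrix.mul_assoc, ← Submonoid.coe_mul, inv_mul_cancel]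
    simp

/-- `N(S)`: the normaliser of `S` in the Pauli group. -/
def pauliNormalizer {n : ℕ} (S : Subgroup (QubitUnitary n)) : Subgroup (QubitUnitary n) :=
  Subgroup.normalizer S ⊓ pauliGroup n

/-- `N(S) / S` for unsigned Paulis, i.e. with global phases divided out as well. -/
abbrev Logicals {n : ℕ} (S : Subgroup (QubitUnitary n)) :=
  pauliNormalizer S ⧸ (S ⊔ phaseGroup n).subgroupOf (pauliNormalizer S)

/-! ### Floquet codes -/

/-- One operation of a measurement schedule on `n` qubits. -/
inductive Operation (n : ℕ) where
  | measurement (P : PauliString n)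
  | unitary (U : QubitUnitary n) (hU : U ∈ cliffordGroup n)

/-- The linear map of an operation. A measurement of `P` is post-selected on an outcome
(`false` for `+1`, `true` for `-1`), so that it is the projector `(1 ± P) / 2`. -/
def Operation.toMatrix {n : ℕ} (O : Operation n) (outcome : Bool) :
    Matrix (Fin n → Fin 2) (Fin n → Fin 2) ℂ :=
  match O with
  | .measurement P => (1 / 2 : ℂ) • (1 + (if outcome then (-1 : ℂ) else 1) • pauliMatrix P)
  | .unitary U _ => U

/-- A Floquet code on `n` qubits: a (non-empty) measurement schedule, repeated forever. -/
structure FloquetCode (n : ℕ) where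
  schedule : List (Operation n)
  schedule_ne_nil : schedule ≠ []

/-- The operation performed in the time step with number `j` (counted from `0`). -/
def FloquetCode.op {n : ℕ} (F : FloquetCode n) (j : ℕ) : Operation n :=
  F.schedule[j % F.schedule.length]'
    (Nat.mod_lt _ (List.length_pos_iff.mpr F.schedule_ne_nil))

/-- The linear map of the first `t` time steps, when the measurement in time step `j`
(if there is one) has the outcome `o j`. -/
def FloquetCode.circuit {n : ℕ} (F : FloquetCode n) (o : ℕ → Bool) :
    ℕ → Matrix (Fin n → Fin 2) (Fin n → Fin 2) ℂ
  | 0 => 1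
  | t + 1 => (F.op t).toMatrix (o t) * F.circuit o t

/-- The instantaneous stabiliser group after `t` time steps: the Pauli operators
stabilised by the circuit of the first `t` operations. -/
def FloquetCode.instStabGroup {n : ℕ} (F : FloquetCode n) (o : ℕ → Bool) (t : ℕ) :
    Subgroup (QubitUnitary n) :=
  stabiliserGroup (F.circuit o t)

/-! ### ZX diagrams -/

/-- Vertex types: Z spider, X spider, Hadamard node, boundary node. -/
inductive NodeType where
  | Z | X | H | B

/-- A Clifford ZX diagram with vertices `V`, edges `E`, `m` inputs and `n` outputs. The two legs
(half-edges) of the edge `e` are `(e, false)` and `(e, true)`, and `ends` sends a leg to the vertex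
that it is attached to; the order of the two legs of an edge is irrelevant. Parallel edges and
self-loops are allowed. The phase `k : ZMod 4` of a spider stands for `k * π / 2`. -/
structure ZXDiagram (V E : Type*) [Fintype V] [Fintype E] (m n : ℕ) where
  ends : E × Bool → V
  type : V → NodeType
  phase : V → ZMod 4
  /-- The boundary nodes are the inputs and the outputs. -/
  boundary : Fin m ⊕ Fin n ≃ {v : V // type v = NodeType.B}
  hadamard_degree : ∀ v, type v = NodeType.H → Nat.card {l : E × Bool // ends l = v} = 2
  boundary_degree : ∀ v, type v = NodeType.B → Nat.card {l : E × Bool // ends l = v} = 1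

namespace ZXDiagram

variable {V E : Type*} [Fintype V] [Fintype E] {m n : ℕ} (D : ZXDiagram V E m n)

/-- The `i`-th input node. -/
def input (i : Fin m) : V := (D.boundary (Sum.inl i)).1

/-- The `j`-th output node. -/
def output (j : Fin n) : V := (D.boundary (Sum.inr j)).1

open Classical in
/-- The legs of a vertex. A self-loop contributes two legs. -/
def legs (v : V) : Finset (E × Bool) := {l | D.ends l = v}

open Classical in
/-- The tensor of the vertex `v`, evaluated at the basis labels `σ` of the edges:
`|0…0⟩ + e^{ikπ/2} |1…1⟩` for a Z spider, `|+…+⟩ + e^{ikπ/2} |-…-⟩` for an X spider, and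
`2^{-1/2} (-1)^{ab}` for a Hadamard node with legs labelled `a` and `b`. -/
def tensor (σ : E → Fin 2) (v : V) : ℂ :=
  match D.type v with
  | .Z => (if ∀ l ∈ D.legs v, σ l.1 = 0 then 1 else 0) +
      Complex.I ^ (D.phase v).val * (if ∀ l ∈ D.legs v, σ l.1 = 1 then 1 else 0)
  | .X => (∏ _l ∈ D.legs v, (1 / (√2 : ℂ))) +
      Complex.I ^ (D.phase v).val * ∏ l ∈ D.legs v, ((-1) ^ (σ l.1).val / (√2 : ℂ))
  | .H => (1 / (√2 : ℂ)) * (if ∀ l ∈ D.legs v, σ l.1 = 1 then -1 else 1)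
  | .B => 1

open Classical in
/-- The interpretation of a diagram as a linear map from `m` to `n` qubits: contract the tensors
of the vertices along the edges. -/
def interp : Matrix (Fin n → Fin 2) (Fin m → Fin 2) ℂ := fun y x =>
  ∑ σ : E → Fin 2,
    if (∀ i, ∀ l ∈ D.legs (D.input i), σ l.1 = x i) ∧
        (∀ j, ∀ l ∈ D.legs (D.output j), σ l.1 = y j)
    then ∏ v, D.tensor σ v else 0

/-- The diagram represents the linear map `M`, up to a non-zero scalar. -/
def Represents (M : Matrix (Fin n → Fin 2) (Fin m → Fin 2) ℂ) : Prop :=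
  ∃ c : ℂ, c ≠ 0 ∧ D.interp = c • M

end ZXDiagram

/-! ### Pauli webs -/

/-- The two colours: green (`Z`) and red (`X`). -/
inductive Colour where
  | Z | X

/-- The Pauli letter of a (possibly) highlighted edge. -/
def pauliOfColours (z x : Prop) [Decidable z] [Decidable x] : Pauli :=
  if z then (if x then .Y else .Z) else (if x then .X else .I)

/-- The quotient equivalence classes `G / N = {g ∆ N : g ∈ G}`, where `g ∆ N = {g ∆ n : n ∈ N}`. -/
def quotientClasses {α : Type*} (G N : Set (Set α)) (_h : ∀ g ∈ G, ∀ n ∈ N, g ∆ n ∈ G) :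
    Set (Set (Set α)) :=
  {A | ∃ g ∈ G, A = {w | ∃ n ∈ N, w = g ∆ n}}

namespace ZXDiagram

variable {V E : Type*} [Fintype V] [Fintype E] {m n : ℕ} (D : ZXDiagram V E m n)

open Classical in
/-- The legs of `v` that lie on an edge highlighted in the colour `c`. -/
def highlighted (w : Set (E × Colour)) (v : V) (c : Colour) : Finset (E × Bool) :=
  {l ∈ D.legs v | (l.1, c) ∈ w}

/-- The condition at a spider `v` of colour `own`, where `opp` is the opposite colour. -/
def SpiderRule (w : Set (E × Colour)) (v : V) (own opp : Colour) : Prop :=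
  (D.phase v = 0 ∨ D.phase v = 2 →
    Even (D.highlighted w v own).card ∧
      (D.highlighted w v opp = D.legs v ∨ D.highlighted w v opp = ∅)) ∧
  (D.phase v = 1 ∨ D.phase v = 3 →
    (Even (D.highlighted w v own).card ∧ D.highlighted w v opp = ∅) ∨
      (Odd (D.highlighted w v own).card ∧ D.highlighted w v opp = D.legs v))

/-- The condition at a Hadamard node: the colours are exchanged between its two legs. -/
def HadamardRule (w : Set (E × Colour)) (v : V) : Prop :=
  ∀ l ∈ D.legs v, ∀ l' ∈ D.legs v, l ≠ l' → ((l.1, Colour.Z) ∈ w ↔ (l'.1, Colour.X) ∈ w)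

/-- A Pauli web: a set of pairs of an edge and a colour that obeys the rule of every vertex. -/
def IsPauliWeb (w : Set (E × Colour)) : Prop :=
  ∀ v, match D.type v with
    | .Z => D.SpiderRule w v .Z .X
    | .X => D.SpiderRule w v .X .Z
    | .H => D.HadamardRule w v
    | .B => True

/-- The web highlights no edge attached to `v`. -/
def Avoids (w : Set (E × Colour)) (v : V) : Prop := ∀ c, D.highlighted w v c = ∅

/-- All Pauli webs. -/
def pauliWebs : Set (Set (E × Colour)) := {w | D.IsPauliWeb w}

/-- Pauli webs that highlight no input edges. -/
def stabilisingWebs : Set (Set (E × Colour)) :=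
  {w | D.IsPauliWeb w ∧ ∀ i, D.Avoids w (D.input i)}

/-- Pauli webs that highlight no output edges. -/
def coStabilisingWebs : Set (Set (E × Colour)) :=
  {w | D.IsPauliWeb w ∧ ∀ j, D.Avoids w (D.output j)}

/-- Pauli webs that highlight no boundary edges. -/
def detectingRegions : Set (Set (E × Colour)) :=
  {w | D.IsPauliWeb w ∧ (∀ i, D.Avoids w (D.input i)) ∧ ∀ j, D.Avoids w (D.output j)}

/-- The combinations of stabilising and co-stabilising webs. -/
def trivialWebs : Set (Set (E × Colour)) :=
  {w | ∃ s ∈ D.stabilisingWebs, ∃ c ∈ D.coStabilisingWebs, w = s ∆ c}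

open Classical in
/-- The Pauli string given by the highlighted output edges. -/
def out (w : Set (E × Colour)) : PauliString n := fun j =>
  pauliOfColours (D.highlighted w (D.output j) .Z).Nonempty
    (D.highlighted w (D.output j) .X).Nonempty

/-! The product of two Pauli webs is a Pauli web. -/

open Classical in
theorem highlighted_symmDiff (w w' : Set (E × Colour)) (v : V) (c : Colour) :
    D.highlighted (w ∆ w') v c = D.highlighted w v c ∆ D.highlighted w' v c := by
  ext l
  simp only [highlighted, Finset.mem_filter, Finset.mem_symmDiff, Set.mem_symmDiff]
  tauto

theorem even_card_symmDiff {α : Type*} [DecidableEq α] (s t : Finset α) :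
    Even (s ∆ t).card ↔ (Even s.card ↔ Even t.card) := by
  have h1 : (s ∆ t).card = (s \ t).card + (t \ s).card := by
    rw [symmDiff_def, Finset.sup_eq_union, Finset.card_union_of_disjoint disjoint_sdiff_sdiff]
  have h2 := Finset.card_sdiff_add_card_inter s t
  have h3 := Finset.card_sdiff_add_card_inter t s
  rw [Finset.inter_comm] at h3
  rw [h1, ← h2, ← h3]
  simp only [Nat.even_add]
  tauto

theorem SpiderRule.symmDiff {w w' : Set (E × Colour)} {v : V} {a b : Colour}
    (h : D.SpiderRule w v a b) (h' : D.SpiderRule w' v a b) : D.SpiderRule (w ∆ w') v a b := by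
  classical
  refine ⟨fun hp => ?_, fun hp => ?_⟩
  · obtain ⟨h1, h2⟩ := h.1 hp
    obtain ⟨h1', h2'⟩ := h'.1 hp
    rw [D.highlighted_symmDiff, D.highlighted_symmDiff, even_card_symmDiff]
    refine ⟨by tauto, ?_⟩
    rcases h2 with h2 | h2 <;> rcases h2' with h2' | h2' <;> rw [h2, h2'] <;>
      simp [← Finset.bot_eq_empty]
  · rw [D.highlighted_symmDiff, D.highlighted_symmDiff, ← Nat.not_even_iff_odd,
      even_card_symmDiff]
    rcases h.2 hp with ⟨h1, h2⟩ | ⟨h1, h2⟩ <;> rcases h'.2 hp with ⟨h1', h2'⟩ | ⟨h1', h2'⟩ <;>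
      rw [h2, h2'] <;> (try simp only [← Nat.not_even_iff_odd] at h1 h1') <;>
      simp [← Finset.bot_eq_empty, h1, h1']

theorem IsPauliWeb.symmDiff {w w' : Set (E × Colour)} (h : D.IsPauliWeb w)
    (h' : D.IsPauliWeb w') : D.IsPauliWeb (w ∆ w') := by
  intro v
  have hv := h v
  have hv' := h' v
  revert hv hv'
  cases D.type v
  · exact fun hv hv' => SpiderRule.symmDiff D hv hv'
  · exact fun hv hv' => SpiderRule.symmDiff D hv hv'
  · intro hv hv' l hl l' hl' hne
    have e := hv l hl l' hl' hne
    have e' := hv' l hl l' hl' hne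
    simp only [Set.mem_symmDiff]
    tauto
  · exact fun _ _ => trivial

theorem Avoids.symmDiff {w w' : Set (E × Colour)} {v : V} (h : D.Avoids w v)
    (h' : D.Avoids w' v) : D.Avoids (w ∆ w') v := by
  classical
  intro c
  rw [D.highlighted_symmDiff, h c, h' c]
  simp [← Finset.bot_eq_empty]

theorem stabilisingWebs_symmDiff :
    ∀ g ∈ D.stabilisingWebs, ∀ d ∈ D.detectingRegions, g ∆ d ∈ D.stabilisingWebs :=
  fun _ hg _ hd => ⟨IsPauliWeb.symmDiff D hg.1 hd.1,
    fun i => Avoids.symmDiff D (hg.2 i) (hd.2.1 i)⟩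

theorem pauliWebs_symmDiff :
    ∀ g ∈ D.pauliWebs, ∀ d ∈ D.trivialWebs, g ∆ d ∈ D.pauliWebs := by
  rintro g hg _ ⟨s, hs, c, hc, rfl⟩
  exact IsPauliWeb.symmDiff D hg (IsPauliWeb.symmDiff D hs.1 hc.1)

end ZXDiagram

end FloquetWebs

end

open FloquetWebs

noncomputable section

namespace FloquetWebs

/-- The opposite colour. -/
def Colour.opp : Colour → Colour
  | .Z => .X
  | .X => .Z

@[simp] theorem Colour.opp_opp (c : Colour) : c.opp.opp = c := by cases c <;> rfl

instance : DecidableEq Colour := Classical.decEq _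

instance : Fintype Colour := ⟨{.Z, .X}, fun c => by cases c <;> simp⟩

theorem sum_colour {M : Type*} [AddCommMonoid M] (f : Colour → M) :
    ∑ c, f c = f .Z + f .X := by
  change ∑ c ∈ {Colour.Z, Colour.X}, f c = _
  rw [Finset.sum_pair (by simp)]

/-- The label in `ZMod 2` of an edge and a colour: `1` if highlighted, `0` if not. -/
def bit {α : Type*} (w : Set α) (p : α) : ZMod 2 :=
  open Classical in if p ∈ w then 1 else 0

theorem bit_eq_one {α : Type*} {w : Set α} {p : α} : bit w p = 1 ↔ p ∈ w := by
  simp [bit]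

theorem bit_eq_zero {α : Type*} {w : Set α} {p : α} : bit w p = 0 ↔ p ∉ w := by
  simp [bit]

theorem zmod_two_ne_zero {a : ZMod 2} : a ≠ 0 ↔ a = 1 := by
  revert a; decide

theorem zmod_two_add_eq_zero {a b : ZMod 2} : a + b = 0 ↔ a = b := by
  revert a b; decide

theorem bit_setOf_eq_one {α : Type*} (d : α → ZMod 2) : bit {p | d p = 1} = d := by
  ext p
  by_cases h : d p = 1
  · rw [h, bit_eq_one]; exact h
  · have h0 : d p = 0 := by
      by_contra h'
      exact h (zmod_two_ne_zero.1 h')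
    rw [h0, bit_eq_zero]; exact h

/-- The labels of the legs induced by labels of the edges. -/
def legLabels {E : Type*} : (E × Colour → ZMod 2) →ₗ[ZMod 2] ((E × Bool) × Colour → ZMod 2) :=
  LinearMap.funLeft (ZMod 2) (ZMod 2) fun p => (p.1.1, p.2)

theorem legLabels_apply {E : Type*} (d : E × Colour → ZMod 2) (l : E × Bool) (c : Colour) :
    legLabels d (l, c) = d (l.1, c) := rfl

namespace ZXDiagram

variable {V E : Type*} [Fintype V] [Fintype E] {m n : ℕ} (D : ZXDiagram V E m n)

theorem mem_legs {l : E × Bool} {v : V} : l ∈ D.legs v ↔ D.ends l = v := by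
  simp [legs]

theorem card_legs (v : V) : (D.legs v).card = Nat.card {l : E × Bool // D.ends l = v} := by
  classical
  rw [Nat.card_eq_fintype_card, Fintype.card_subtype]
  congr 1

theorem mem_highlighted {w : Set (E × Colour)} {v : V} {c : Colour} {l : E × Bool} :
    l ∈ D.highlighted w v c ↔ l ∈ D.legs v ∧ (l.1, c) ∈ w := by
  simp [highlighted]

/-- The linear form of the rule at a spider whose own colour is `own`. -/
def LinearSpiderRule (a : (E × Bool) × Colour → ZMod 2) (v : V) (own : Colour) : Prop :=
  (∀ l ∈ D.legs v, ∀ l' ∈ D.legs v, a (l, own.opp) = a (l', own.opp)) ∧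
    ∀ l ∈ D.legs v, ∑ l' ∈ D.legs v, a (l', own) = ((D.phase v).val : ZMod 2) * a (l, own.opp)

/-- The linear form of the rule at a vertex, for labels of the legs; the boundary nodes in `K` are
required to have label zero. -/
def LinearRule (K : Set V) (a : (E × Bool) × Colour → ZMod 2) (v : V) : Prop :=
  match D.type v with
    | .Z => D.LinearSpiderRule a v .Z
    | .X => D.LinearSpiderRule a v .X
    | .H => ∀ l ∈ D.legs v, ∀ l' ∈ D.legs v, l ≠ l' → a (l, .Z) = a (l', .X)
    | .B => v ∈ K → ∀ l ∈ D.legs v, ∀ c, a (l, c) = 0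

theorem linearRule_zero (K : Set V) (v : V) : D.LinearRule K 0 v := by
  unfold LinearRule
  cases D.type v <;> simp [LinearSpiderRule]

theorem LinearSpiderRule.add {a b : (E × Bool) × Colour → ZMod 2} {v : V} {own : Colour}
    (ha : D.LinearSpiderRule a v own) (hb : D.LinearSpiderRule b v own) :
    D.LinearSpiderRule (a + b) v own := by
  refine ⟨fun l hl l' hl' => ?_, fun l hl => ?_⟩
  · simp only [Pi.add_apply, ha.1 l hl l' hl', hb.1 l hl l' hl']
  · simp only [Pi.add_apply, Finset.sum_add_distrib, ha.2 l hl, hb.2 l hl, mul_add]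

theorem LinearRule.add {K : Set V} {a b : (E × Bool) × Colour → ZMod 2} {v : V}
    (ha : D.LinearRule K a v) (hb : D.LinearRule K b v) : D.LinearRule K (a + b) v := by
  unfold LinearRule at *
  revert ha hb
  cases D.type v
  · exact LinearSpiderRule.add D
  · exact LinearSpiderRule.add D
  · intro ha hb l hl l' hl' hne
    simp only [Pi.add_apply, ha l hl l' hl' hne, hb l hl l' hl' hne]
  · intro ha hb hK l hl c
    simp only [Pi.add_apply, ha hK l hl c, hb hK l hl c, add_zero]

/-- The labellings of the legs that obey the rule of every vertex and vanish on the boundary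
nodes in `K`. -/
def localSpace (K : Set V) : Submodule (ZMod 2) ((E × Bool) × Colour → ZMod 2) where
  carrier := {a | ∀ v, D.LinearRule K a v}
  zero_mem' := D.linearRule_zero K
  add_mem' ha hb v := LinearRule.add D (ha v) (hb v)
  smul_mem' c a ha := by
    by_cases hc : c = 0
    · rw [hc, zero_smul]; exact D.linearRule_zero K
    · rw [zmod_two_ne_zero.1 hc, one_smul]; exact ha

theorem LinearRule.congr {K : Set V} {a b : (E × Bool) × Colour → ZMod 2} {v : V}
    (h : ∀ l ∈ D.legs v, ∀ c, a (l, c) = b (l, c)) (ha : D.LinearRule K a v) :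
    D.LinearRule K b v := by
  have key : ∀ own, D.LinearSpiderRule a v own → D.LinearSpiderRule b v own := by
    refine fun own ha => ⟨fun l hl l' hl' => ?_, fun l hl => ?_⟩
    · rw [← h l hl, ← h l' hl']; exact ha.1 l hl l' hl'
    · rw [← h l hl, ← ha.2 l hl]
      exact Finset.sum_congr rfl fun l' hl' => (h l' hl' _).symm
  unfold LinearRule at *
  revert ha
  cases D.type v
  · exact key _
  · exact key _
  · intro ha l hl l' hl' hne
    rw [← h l hl, ← h l' hl']; exact ha l hl l' hl' hne
  · intro ha hK l hl c
    rw [← h l hl]; exact ha hK l hl c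

theorem mem_localSpace_of_support {K : Set V} {a : (E × Bool) × Colour → ZMod 2} {v : V}
    (h : ∀ l, l ∉ D.legs v → ∀ c, a (l, c) = 0) (ha : D.LinearRule K a v) :
    a ∈ D.localSpace K := by
  intro u
  by_cases hu : u = v
  · rw [hu]; exact ha
  · refine LinearRule.congr D (fun l hl c => ?_) (D.linearRule_zero K u)
    rw [h l (fun hl' => hu ?_) c, Pi.zero_apply]
    rw [← D.mem_legs.1 hl, ← D.mem_legs.1 hl']


open Classical in
/-- The coefficients of a linear functional on labellings, with the two colours exchanged. -/
def coeffs (g : Module.Dual (ZMod 2) ((E × Bool) × Colour → ZMod 2)) :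
    (E × Bool) × Colour → ZMod 2 :=
  fun p => g (Pi.single (p.1, p.2.opp) 1)

theorem spider_coeffs {K : Set V} {v : V} {own : Colour}
    (hr : ∀ a, D.LinearRule K a v ↔ D.LinearSpiderRule a v own)
    {g : Module.Dual (ZMod 2) ((E × Bool) × Colour → ZMod 2)}
    (hg : ∀ a ∈ D.localSpace K, g a = 0) : D.LinearSpiderRule (coeffs g) v own := by
  classical
  have hne : own ≠ own.opp := by cases own <;> simp [Colour.opp]
  refine ⟨fun l hl l' hl' => ?_, fun l hl => ?_⟩
  · have := hg (Pi.single (l, own) 1 + Pi.single (l', own) 1) ?_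
    · rw [map_add, zmod_two_add_eq_zero] at this
      simpa [coeffs] using this
    · refine D.mem_localSpace_of_support (v := v) (fun k hk c => ?_) ((hr _).2 ?_)
      · have h1 : k ≠ l := fun h => hk (h ▸ hl)
        have h2 : k ≠ l' := fun h => hk (h ▸ hl')
        simp [h1, h2]
      · refine ⟨fun k _ k' _ => by simp [hne.symm], fun k hk => ?_⟩
        simp only [Pi.add_apply, Finset.sum_add_distrib, Pi.single_apply, Prod.mk.injEq, and_true,
          Finset.sum_ite_eq', hl, hl', if_true, hne.symm, and_false, if_false]
        simp only [add_zero, mul_zero]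
        decide
  · have := hg (∑ k ∈ D.legs v, Pi.single (k, own.opp) 1 +
        ((D.phase v).val : ZMod 2) • Pi.single (l, own) 1) ?_
    · rw [map_add, zmod_two_add_eq_zero, map_sum, map_smul] at this
      simpa [coeffs] using this
    · refine D.mem_localSpace_of_support (v := v) (fun k hk c => ?_) ((hr _).2 ?_)
      · have h1 : k ≠ l := fun h => hk (h ▸ hl)
        have h2 : ∀ j ∈ D.legs v, (Pi.single (j, own.opp) 1 :
            (E × Bool) × Colour → ZMod 2) (k, c) = 0 := fun j hj =>
          Pi.single_eq_of_ne (fun h : (k, c) = (j, own.opp) => hk ((Prod.mk.inj h).1 ▸ hj)) _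
        simp [Finset.sum_eq_zero h2, h1]
      · have e1 : ∀ k ∈ D.legs v, (∑ j ∈ D.legs v, Pi.single (j, own.opp) 1 +
            ((D.phase v).val : ZMod 2) • Pi.single (l, own) 1 :
              (E × Bool) × Colour → ZMod 2) (k, own.opp) = 1 := by
          intro k hk
          simp [Pi.single_apply, hne.symm, hk]
        have e2 : ∀ k ∈ D.legs v, (∑ j ∈ D.legs v, Pi.single (j, own.opp) 1 +
            ((D.phase v).val : ZMod 2) • Pi.single (l, own) 1 :
              (E × Bool) × Colour → ZMod 2) (k, own) =
                if k = l then ((D.phase v).val : ZMod 2) else 0 := by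
          intro k hk
          simp [Pi.single_apply, hne]
        refine ⟨fun k hk k' hk' => by rw [e1 k hk, e1 k' hk'], fun k hk => ?_⟩
        rw [e1 k hk, Finset.sum_congr rfl e2]
        simp [hl]

/-- The local rules are self-dual, up to exchanging the free and the fixed boundary nodes. -/
theorem linearRule_coeffs {K : Set V} {g : Module.Dual (ZMod 2) ((E × Bool) × Colour → ZMod 2)}
    (hg : ∀ a ∈ D.localSpace K, g a = 0) : coeffs g ∈ D.localSpace Kᶜ := by
  classical
  intro v
  cases hv : D.type v
  · have hr : ∀ (L : Set V) a, D.LinearRule L a v ↔ D.LinearSpiderRule a v .Z := fun L a => by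
      simp only [LinearRule, hv]
    exact (hr _ _).2 (D.spider_coeffs (hr K) hg)
  · have hr : ∀ (L : Set V) a, D.LinearRule L a v ↔ D.LinearSpiderRule a v .X := fun L a => by
      simp only [LinearRule, hv]
    exact (hr _ _).2 (D.spider_coeffs (hr K) hg)
  · have hr : ∀ (L : Set V) a, D.LinearRule L a v ↔
        ∀ l ∈ D.legs v, ∀ l' ∈ D.legs v, l ≠ l' → a (l, .Z) = a (l', .X) := fun L a => by
      simp only [LinearRule, hv]
    refine (hr _ _).2 fun l hl l' hl' hne => ?_
    have hlegs : D.legs v = {l, l'} := by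
      refine (Finset.eq_of_subset_of_card_le ?_ ?_).symm
      · simp [Finset.insert_subset_iff, hl, hl']
      · rw [D.card_legs, D.hadamard_degree v hv, Finset.card_pair hne]
    have := hg (Pi.single (l, .X) 1 + Pi.single (l', .Z) 1) ?_
    · rw [map_add, zmod_two_add_eq_zero] at this
      exact this
    · refine D.mem_localSpace_of_support (v := v) (fun k hk c => ?_) ((hr _ _).2 ?_)
      · have h1 : k ≠ l := fun h => hk (h ▸ hl)
        have h2 : k ≠ l' := fun h => hk (h ▸ hl')
        simp [h1, h2]
      · intro k hk k' hk' hkk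
        rw [hlegs, Finset.mem_insert, Finset.mem_singleton] at hk hk'
        rcases hk with rfl | rfl <;> rcases hk' with rfl | rfl <;>
          simp [hne, hne.symm] at hkk ⊢
  · have hr : ∀ (L : Set V) a, D.LinearRule L a v ↔
        (v ∈ L → ∀ l ∈ D.legs v, ∀ c, a (l, c) = 0) := fun L a => by
      simp only [LinearRule, hv]
    refine (hr _ _).2 fun hK l hl c => hg _ ?_
    refine D.mem_localSpace_of_support (v := v) (fun k hk c => ?_) ((hr _ _).2 fun h => ?_)
    · have h1 : k ≠ l := fun h => hk (h ▸ hl)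
      simp [h1]
    · exact absurd h hK

theorem spiderRule_iff_linear (w : Set (E × Colour)) (v : V) (own : Colour) :
    D.SpiderRule w v own own.opp ↔ D.LinearSpiderRule (legLabels (bit w)) v own := by
  classical
  have hsum : ∑ l ∈ D.legs v, legLabels (bit w) (l, own) =
      ((D.highlighted w v own).card : ZMod 2) := by
    simp only [legLabels_apply, bit, highlighted, Finset.card_filter, Nat.cast_sum, Nat.cast_ite,
      Nat.cast_one, Nat.cast_zero]
  have hall : D.highlighted w v own.opp = D.legs v ↔
      ∀ l ∈ D.legs v, legLabels (bit w) (l, own.opp) = 1 := by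
    simp only [legLabels_apply, bit_eq_one, highlighted, Finset.filter_eq_self]
  have hnone : D.highlighted w v own.opp = ∅ ↔
      ∀ l ∈ D.legs v, legLabels (bit w) (l, own.opp) = 0 := by
    simp only [legLabels_apply, bit_eq_zero, highlighted, Finset.filter_eq_empty_iff]
  have hodd : Odd (D.highlighted w v own).card ↔
      ∑ l ∈ D.legs v, legLabels (bit w) (l, own) = 1 := by
    rw [hsum, ZMod.natCast_eq_one_iff_odd]
  have heven : Even (D.highlighted w v own).card ↔
      ∑ l ∈ D.legs v, legLabels (bit w) (l, own) = 0 := by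
    rw [hsum, ZMod.natCast_eq_zero_iff_even]
  have hphase : (((D.phase v).val : ZMod 2) = 0 ∧ (D.phase v = 0 ∨ D.phase v = 2)
      ∧ ¬ (D.phase v = 1 ∨ D.phase v = 3)) ∨ (((D.phase v).val : ZMod 2) = 1 ∧
        (D.phase v = 1 ∨ D.phase v = 3) ∧ ¬ (D.phase v = 0 ∨ D.phase v = 2)) := by
    generalize D.phase v = p
    revert p
    decide
  unfold SpiderRule LinearSpiderRule
  rw [hall, hnone, hodd, heven]
  generalize ∑ l ∈ D.legs v, legLabels (bit w) (l, own) = s at *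
  generalize hb : (fun l => legLabels (bit w) (l, own.opp)) = b
  replace hb := congrFun hb
  simp only [hb]
  rcases (D.legs v).eq_empty_or_nonempty with he | ⟨l0, hl0⟩
  · have hs : s = 0 := by
      rw [hsum]
      simp [highlighted, he]
    rcases hphase with ⟨-, hp, hq⟩ | ⟨-, hp, hq⟩ <;> simp [he, hp, hq, hs]
  · have h01 : b l0 = 0 ∨ b l0 = 1 := by
      rw [← zmod_two_ne_zero]; exact em _
    rcases hphase with ⟨hk, hp, hq⟩ | ⟨hk, hp, hq⟩
    · simp only [hp, hq, hk, zero_mul, true_imp_iff, false_imp_iff, and_true]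
      constructor
      · rintro ⟨hs, h | h⟩
        · exact ⟨fun l hl l' hl' => by rw [h l hl, h l' hl'], fun _ _ => hs⟩
        · exact ⟨fun l hl l' hl' => by rw [h l hl, h l' hl'], fun _ _ => hs⟩
      · rintro ⟨h, hs⟩
        refine ⟨hs l0 hl0, ?_⟩
        rcases h01 with h0 | h0
        · exact Or.inr fun l hl => by rw [h l hl l0 hl0, h0]
        · exact Or.inl fun l hl => by rw [h l hl l0 hl0, h0]
    · simp only [hp, hq, hk, one_mul, true_imp_iff, false_imp_iff, true_and]
      constructor
      · rintro (⟨hs, h⟩ | ⟨hs, h⟩)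
        · exact ⟨fun l hl l' hl' => by rw [h l hl, h l' hl'], fun l hl => by rw [hs, h l hl]⟩
        · exact ⟨fun l hl l' hl' => by rw [h l hl, h l' hl'], fun l hl => by rw [hs, h l hl]⟩
      · rintro ⟨h, hs⟩
        rcases h01 with h0 | h0
        · exact Or.inl ⟨by rw [hs l0 hl0, h0], fun l hl => by rw [h l hl l0 hl0, h0]⟩
        · exact Or.inr ⟨by rw [hs l0 hl0, h0], fun l hl => by rw [h l hl l0 hl0, h0]⟩

theorem mem_localSpace_iff (K : Set V) (w : Set (E × Colour)) :
    legLabels (bit w) ∈ D.localSpace K ↔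
      D.IsPauliWeb w ∧ ∀ v ∈ K, D.type v = .B → D.Avoids w v := by
  change (∀ v, D.LinearRule K _ v) ↔ _
  unfold IsPauliWeb
  rw [← forall_and]
  refine forall_congr' fun v => ?_
  unfold LinearRule
  cases hv : D.type v
  · simpa using (show D.SpiderRule w v .Z .X ↔ _ from D.spiderRule_iff_linear w v .Z).symm
  · simpa using (show D.SpiderRule w v .X .Z ↔ _ from D.spiderRule_iff_linear w v .X).symm
  · have key : ∀ l l' : E × Bool, (legLabels (bit w) (l, .Z) = legLabels (bit w) (l', .X)) ↔
        ((l.1, Colour.Z) ∈ w ↔ (l'.1, Colour.X) ∈ w) := by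
      intro l l'
      simp only [legLabels_apply]
      by_cases h1 : (l.1, Colour.Z) ∈ w <;> by_cases h2 : (l'.1, Colour.X) ∈ w <;>
        simp [bit, h1, h2]
    simp [HadamardRule, key]
  · simp only [Avoids, highlighted, Finset.filter_eq_empty_iff, legLabels_apply, bit_eq_zero,
      true_and, true_imp_iff]
    exact forall_congr' fun _ => ⟨fun h c l hl => h l hl c, fun h l hl c => h c hl⟩

/-- Labels of the free boundary nodes that are symplectically orthogonal to every web avoiding the
other boundary nodes extend to a web. -/
theorem exists_web (K : Set V) (φ : (E × Bool) × Colour → ZMod 2)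
    (hφ : ∀ l c, φ (l, c) ≠ 0 → D.type (D.ends l) = .B ∧ D.ends l ∉ K)
    (horth : ∀ w, D.IsPauliWeb w → (∀ v ∈ K, D.type v = .B → D.Avoids w v) →
      ∑ l, ∑ c, φ (l, c) * bit w (l.1, c.opp) = 0) :
    ∃ w, D.IsPauliWeb w ∧
      ∀ l, D.type (D.ends l) = .B → D.ends l ∉ K → ∀ c, bit w (l.1, c) = φ (l, c) := by
  classical
  let f : Module.Dual (ZMod 2) ((E × Bool) × Colour → ZMod 2) :=
    ∑ l, ∑ c, φ (l, c) • LinearMap.proj (l, c.opp)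
  have hf_apply : ∀ a, f a = ∑ l, ∑ c, φ (l, c) * a (l, c.opp) := fun a => by
    simp [f, LinearMap.sum_apply]
  have hcf : coeffs f = φ := by
    ext ⟨l, c⟩
    rw [coeffs, hf_apply, Finset.sum_eq_single l, Finset.sum_eq_single c]
    · simp
    · intro b _ hb
      cases b <;> cases c <;> simp_all [Colour.opp]
    · simp
    · intro b _ hb
      simp [hb]
    · simp
  have hf : f ∈ (LinearMap.range (legLabels (E := E)) ⊓ D.localSpace K).dualAnnihilator := by
    rw [Submodule.mem_dualAnnihilator]
    rintro _ ⟨⟨d, rfl⟩, hd⟩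
    rw [← bit_setOf_eq_one d] at hd ⊢
    obtain ⟨h1, h2⟩ := (D.mem_localSpace_iff K _).1 hd
    rw [hf_apply]
    exact horth _ h1 h2
  rw [Subspace.dualAnnihilator_inf_eq, Submodule.mem_sup] at hf
  obtain ⟨g, hg, h, hh, hgh⟩ := hf
  rw [Submodule.mem_dualAnnihilator] at hg hh
  have hd : ∀ e c, coeffs g ((e, false), c) = coeffs g ((e, true), c) := by
    intro e c
    have := hg _ ⟨Pi.single (e, c.opp) 1, rfl⟩
    have hs : legLabels (Pi.single (e, c.opp) 1 : E × Colour → ZMod 2) =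
        Pi.single ((e, false), c.opp) 1 + Pi.single ((e, true), c.opp) 1 := by
      ext ⟨⟨e', b⟩, c'⟩
      rw [legLabels_apply]
      cases b <;> simp [Pi.single_apply]
    rw [hs, map_add, zmod_two_add_eq_zero] at this
    exact this
  let w : Set (E × Colour) := {p | coeffs g ((p.1, false), p.2) = 1}
  have hw : legLabels (bit w) = coeffs g := by
    ext ⟨⟨e, b⟩, c⟩
    rw [bit_setOf_eq_one, legLabels_apply]
    cases b
    · rfl
    · exact hd e c
  have hsum : φ = coeffs g + coeffs h := by
    rw [← hcf, ← hgh]; rfl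
  have hh' := D.linearRule_coeffs hh
  have hzero : ∀ l, D.type (D.ends l) = .B → D.ends l ∉ K → ∀ c, coeffs h (l, c) = 0 := by
    intro l hl hK c
    have := hh' (D.ends l)
    simp only [LinearRule, hl] at this
    exact this hK l (D.mem_legs.2 rfl) c
  have hφmem : φ ∈ D.localSpace (∅ : Set V) := by
    intro v
    cases hv : D.type v
    case B => simp [LinearRule, hv]
    all_goals
      refine LinearRule.congr D (fun l hl c => ?_) (D.linearRule_zero ∅ v)
      by_contra hne
      have := (hφ l c (Ne.symm hne)).1
      rw [D.mem_legs.1 hl, hv] at this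
      cases this
  have hh0 : coeffs h ∈ D.localSpace (∅ : Set V) := by
    intro v
    cases hv : D.type v
    case B => simp [LinearRule, hv]
    all_goals
      have := hh' v
      simp only [LinearRule, hv] at this ⊢
      exact this
  refine ⟨w, ((D.mem_localSpace_iff ∅ w).1 ?_).1, fun l hl hK c => ?_⟩
  · rw [hw, eq_sub_of_add_eq hsum.symm]
    exact Submodule.sub_mem _ hφmem hh0
  · have := congrFun hw (l, c)
    rw [legLabels_apply] at this
    rw [this, hsum, Pi.add_apply, hzero l hl hK c, add_zero]

end ZXDiagram

/-- The exponent of `Z` in a Pauli letter. -/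
def Pauli.zbit : Pauli → Fin 2
  | .I => 0
  | .X => 0
  | .Y => 1
  | .Z => 1

/-- The exponent of `X` in a Pauli letter. -/
def Pauli.xbit : Pauli → Fin 2
  | .I => 0
  | .X => 1
  | .Y => 1
  | .Z => 0

/-- The sign `(-1)ᵃ`. -/
def sgn (a : Fin 2) : ℂ := (-1) ^ a.val

@[simp] theorem sgn_zero : sgn 0 = 1 := by simp [sgn]
@[simp] theorem sgn_one : sgn 1 = -1 := by simp [sgn]

theorem sgn_add (a b : Fin 2) : sgn (a + b) = sgn a * sgn b := by
  fin_cases a <;> fin_cases b <;> simp [sgn]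

theorem sgn_mul_self (a : Fin 2) : sgn a * sgn a = 1 := by
  fin_cases a <;> simp [sgn]

theorem sgn_ne_zero (a : Fin 2) : sgn a ≠ 0 := left_ne_zero_of_mul_eq_one (sgn_mul_self a)

theorem fin_two_add_self (a : Fin 2) : a + a = 0 := by revert a; decide

theorem Pauli.toMatrix_apply (p : Pauli) : ∃ θ : ℂ, θ ≠ 0 ∧ ∀ a b,
    p.toMatrix a b = if b = a + p.xbit then θ * sgn (p.zbit * a) else 0 := by
  cases p
  · exact ⟨1, one_ne_zero, fun a b => by
      fin_cases a <;> fin_cases b <;> simp [Pauli.toMatrix, Pauli.xbit, Pauli.zbit]⟩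
  · exact ⟨1, one_ne_zero, fun a b => by
      fin_cases a <;> fin_cases b <;> simp [Pauli.toMatrix, Pauli.xbit, Pauli.zbit]⟩
  · exact ⟨-Complex.I, neg_ne_zero.2 Complex.I_ne_zero, fun a b => by
      fin_cases a <;> fin_cases b <;> simp [Pauli.toMatrix, Pauli.xbit, Pauli.zbit]⟩
  · exact ⟨1, one_ne_zero, fun a b => by
      fin_cases a <;> fin_cases b <;> simp [Pauli.toMatrix, Pauli.xbit, Pauli.zbit]⟩

theorem pauliMatrix_apply {n : ℕ} (P : PauliString n) : ∃ θ : ℂ, θ ≠ 0 ∧ ∀ y x,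
    pauliMatrix P y x = if x = y + (fun i => (P i).xbit) then
      θ * ∏ i, sgn ((P i).zbit * y i) else 0 := by
  choose θ hθ h using fun i => (P i).toMatrix_apply
  refine ⟨∏ i, θ i, Finset.prod_ne_zero_iff.2 fun i _ => hθ i, fun y x => ?_⟩
  simp only [pauliMatrix, h]
  split_ifs with hx
  · rw [← Finset.prod_mul_distrib]
    refine Finset.prod_congr rfl fun i _ => if_pos ?_
    rw [hx]; rfl
  · obtain ⟨i, hi⟩ := Function.ne_iff.1 hx
    exact Finset.prod_eq_zero (Finset.mem_univ i) (if_neg hi)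

/-- A matrix whose entries are permuted and multiplied by signs as two Pauli strings prescribe is,
up to a scalar, preserved by these Pauli strings. -/
theorem pauliMatrix_mul_mul_pauliMatrix {m n : ℕ} (P : PauliString n) (Q : PauliString m)
    (M : Matrix (Fin n → Fin 2) (Fin m → Fin 2) ℂ) (ε : ℂ) (hε : ε ≠ 0)
    (h : ∀ y x, M (y + fun j => (P j).xbit) (x + fun i => (Q i).xbit) =
      ε * ((∏ i, sgn ((Q i).zbit * x i)) * ∏ j, sgn ((P j).zbit * y j)) * M y x) :
    ∃ c : ℂ, c ≠ 0 ∧ pauliMatrix P * M * pauliMatrix Q = c • M := by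
  obtain ⟨θ, hθ, hP⟩ := pauliMatrix_apply P
  obtain ⟨η, hη, hQ⟩ := pauliMatrix_apply Q
  have hsq : ∀ {k : ℕ} (z y : Fin k → Fin 2), (∏ j, sgn (z j * y j)) * ∏ j, sgn (z j * y j) = 1 := by
    intro k z y
    rw [← Finset.prod_mul_distrib]
    exact Finset.prod_eq_one fun j _ => sgn_mul_self _
  refine ⟨θ * η * ε * ∏ i, sgn ((Q i).zbit * (Q i).xbit), ?_, ?_⟩
  · exact mul_ne_zero (mul_ne_zero (mul_ne_zero hθ hη) hε)
      (Finset.prod_ne_zero_iff.2 fun i _ => sgn_ne_zero _)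
  ext y x
  have hflip : ∀ x' : Fin m → Fin 2, x = x' + (fun i => (Q i).xbit) ↔
      x' = x + (fun i => (Q i).xbit) := by
    have h2 : ∀ a : Fin m → Fin 2, a + (fun i => (Q i).xbit) + (fun i => (Q i).xbit) = a := by
      intro a; ext1 i
      simp only [Pi.add_apply, add_assoc, fin_two_add_self, add_zero]
    exact fun x' => ⟨fun h => by rw [h, h2], fun h => by rw [h, h2]⟩
  simp only [Matrix.mul_apply, hP, hQ, hflip, ite_mul, zero_mul, mul_ite, mul_zero,
    Finset.sum_ite_eq', Finset.mem_univ, if_true]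
  rw [h, Matrix.smul_apply, smul_eq_mul]
  have e : ∏ i, sgn ((Q i).zbit * (x + fun i => (Q i).xbit) i) =
      (∏ i, sgn ((Q i).zbit * x i)) * ∏ i, sgn ((Q i).zbit * (Q i).xbit) := by
    rw [← Finset.prod_mul_distrib]
    refine Finset.prod_congr rfl fun i _ => ?_
    rw [← sgn_add, ← mul_add, Pi.add_apply]
  rw [e]
  linear_combination (θ * η * ε * M y x * ∏ i, sgn ((Q i).zbit * (Q i).xbit)) *
    ((∏ i, sgn ((Q i).zbit * x i)) * (∏ i, sgn ((Q i).zbit * x i)) *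
      hsq (fun j => (P j).zbit) y + hsq (fun j => (Q j).zbit) x)

/-- The label in `Fin 2` of an edge and a colour: `1` if highlighted, `0` if not. -/
def fbit {E : Type*} (w : Set (E × Colour)) (c : Colour) (e : E) : Fin 2 :=
  open Classical in if (e, c) ∈ w then 1 else 0

namespace ZXDiagram

variable {V E : Type*} [Fintype V] [Fintype E] {m n : ℕ} (D : ZXDiagram V E m n)

theorem prod_sgn_fbit (w : Set (E × Colour)) (v : V) (c : Colour) :
    ∏ l ∈ D.legs v, sgn (fbit w c l.1) = (-1) ^ (D.highlighted w v c).card := by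
  classical
  rw [highlighted, Finset.card_filter, Finset.prod_pow_eq_pow_sum _ _ _ |>.symm]
  refine Finset.prod_congr rfl fun l _ => ?_
  by_cases h : (l.1, c) ∈ w <;> simp [fbit, h]

theorem fbit_eq_one_of_highlighted {w : Set (E × Colour)} {v : V} {c : Colour}
    (h : D.highlighted w v c = D.legs v) : ∀ l ∈ D.legs v, fbit w c l.1 = 1 := by
  intro l hl
  rw [← h, D.mem_highlighted] at hl
  exact if_pos hl.2

theorem fbit_eq_zero_of_highlighted {w : Set (E × Colour)} {v : V} {c : Colour}
    (h : D.highlighted w v c = ∅) : ∀ l ∈ D.legs v, fbit w c l.1 = 0 := by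
  intro l hl
  refine if_neg fun hw => ?_
  have : l ∈ D.highlighted w v c := D.mem_highlighted.2 ⟨hl, hw⟩
  rw [h] at this
  cases this

theorem I_pow_val_sq (k : ZMod 4) : (Complex.I ^ k.val) * Complex.I ^ k.val = (-1) ^ k.val := by
  rw [← mul_pow, Complex.I_mul_I]

theorem neg_one_pow_phase {w : Set (E × Colour)} {v : V} {own opp : Colour}
    (h : D.SpiderRule w v own opp) :
    (((-1 : ℂ) ^ (D.highlighted w v own).card = 1 ∧ D.highlighted w v opp = ∅) ∨
      ((-1 : ℂ) ^ (D.highlighted w v own).card = (-1) ^ (D.phase v).val ∧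
        D.highlighted w v opp = D.legs v)) := by
  have hphase : (Even (D.phase v).val ∧ (D.phase v = 0 ∨ D.phase v = 2)) ∨
      (Odd (D.phase v).val ∧ (D.phase v = 1 ∨ D.phase v = 3)) := by
    generalize D.phase v = p
    revert p
    decide
  rcases hphase with ⟨hk, hp⟩ | ⟨hk, hp⟩
  · obtain ⟨h1, h2 | h2⟩ := h.1 hp
    · exact Or.inr ⟨by rw [h1.neg_one_pow, hk.neg_one_pow], h2⟩
    · exact Or.inl ⟨h1.neg_one_pow, h2⟩
  · rcases h.2 hp with ⟨h1, h2⟩ | ⟨h1, h2⟩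
    · exact Or.inl ⟨h1.neg_one_pow, h2⟩
    · exact Or.inr ⟨by rw [h1.neg_one_pow, hk.neg_one_pow], h2⟩

/-- The effect of a Pauli web on the tensor of a Z spider. -/
theorem tensor_Z {w : Set (E × Colour)} {v : V} (hv : D.type v = .Z)
    (h : D.SpiderRule w v .Z .X) : ∃ ε : ℂ, ε ≠ 0 ∧ ∀ σ : E → Fin 2,
      D.tensor (σ + fbit w .X) v * ∏ l ∈ D.legs v, sgn (fbit w .Z l.1 * σ l.1) =
        ε * D.tensor σ v := by
  classical
  have hc := D.prod_sgn_fbit w v .Z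
  have hI := I_pow_val_sq (D.phase v)
  have hp0 : ∀ σ : E → Fin 2, (∀ l ∈ D.legs v, σ l.1 = 0) →
      ∏ l ∈ D.legs v, sgn (fbit w .Z l.1 * σ l.1) = 1 := fun σ h0 =>
    Finset.prod_eq_one fun l hl => by rw [h0 l hl, mul_zero, sgn_zero]
  have hp1 : ∀ σ : E → Fin 2, (∀ l ∈ D.legs v, σ l.1 = 1) →
      ∏ l ∈ D.legs v, sgn (fbit w .Z l.1 * σ l.1) =
        (-1) ^ (D.highlighted w v .Z).card := fun σ h0 => by
    rw [← hc]
    exact Finset.prod_congr rfl fun l hl => by rw [h0 l hl, mul_one]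
  simp only [tensor, hv]
  rcases D.neg_one_pow_phase h with ⟨hs, ho⟩ | ⟨hs, ho⟩
  · have hx := D.fbit_eq_zero_of_highlighted ho
    refine ⟨1, one_ne_zero, fun σ => ?_⟩
    have e0 : ∀ a : Fin 2, (∀ l ∈ D.legs v, (σ + fbit w .X) l.1 = a) ↔
        ∀ l ∈ D.legs v, σ l.1 = a := fun a =>
      forall₂_congr fun l hl => by rw [Pi.add_apply, hx l hl, add_zero]
    simp only [e0]
    by_cases h0 : ∀ l ∈ D.legs v, σ l.1 = 0
    · rw [hp0 σ h0, mul_one, one_mul]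
    · by_cases h1 : ∀ l ∈ D.legs v, σ l.1 = 1
      · rw [hp1 σ h1, hs, mul_one, one_mul]
      · simp only [if_neg h0, if_neg h1]; ring
  · have hx := D.fbit_eq_one_of_highlighted ho
    refine ⟨Complex.I ^ (D.phase v).val, pow_ne_zero _ Complex.I_ne_zero, fun σ => ?_⟩
    have e0 : (∀ l ∈ D.legs v, (σ + fbit w .X) l.1 = 0) ↔
        ∀ l ∈ D.legs v, σ l.1 = 1 :=
      forall₂_congr fun l hl => by
        rw [Pi.add_apply, hx l hl]; generalize σ l.1 = a; revert a; decide
    have e1 : (∀ l ∈ D.legs v, (σ + fbit w .X) l.1 = 1) ↔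
        ∀ l ∈ D.legs v, σ l.1 = 0 :=
      forall₂_congr fun l hl => by
        rw [Pi.add_apply, hx l hl]; generalize σ l.1 = a; revert a; decide
    simp only [e0, e1]
    by_cases h0 : ∀ l ∈ D.legs v, σ l.1 = 0
    · rw [hp0 σ h0, if_pos h0]
      by_cases h1 : ∀ l ∈ D.legs v, σ l.1 = 1
      · have := hp1 σ h1
        rw [hp0 σ h0, hs] at this
        rw [if_pos h1]
        linear_combination this - hI
      · rw [if_neg h1]; ring
    · by_cases h1 : ∀ l ∈ D.legs v, σ l.1 = 1
      · rw [hp1 σ h1, hs, if_pos h1, if_neg h0]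
        linear_combination -hI
      · simp only [if_neg h0, if_neg h1]; ring

/-- The effect of a Pauli web on the tensor of an X spider. -/
theorem tensor_X {w : Set (E × Colour)} {v : V} (hv : D.type v = .X)
    (h : D.SpiderRule w v .X .Z) : ∃ ε : ℂ, ε ≠ 0 ∧ ∀ σ : E → Fin 2,
      D.tensor (σ + fbit w .X) v * ∏ l ∈ D.legs v, sgn (fbit w .Z l.1 * σ l.1) =
        ε * D.tensor σ v := by
  classical
  have hc := D.prod_sgn_fbit w v .X
  have hI := I_pow_val_sq (D.phase v)
  have hk : ((-1 : ℂ) ^ (D.phase v).val) * (-1) ^ (D.phase v).val = 1 := by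
    rw [← mul_pow]; simp
  have hprod : ∀ σ : E → Fin 2, ∏ l ∈ D.legs v, ((-1 : ℂ) ^ (σ l.1).val / (√2 : ℂ)) =
      (∏ l ∈ D.legs v, sgn (σ l.1)) * ∏ _l ∈ D.legs v, (1 / (√2 : ℂ)) := fun σ => by
    rw [← Finset.prod_mul_distrib]
    exact Finset.prod_congr rfl fun l _ => by rw [sgn]; ring
  have hshift : ∀ σ : E → Fin 2, ∏ l ∈ D.legs v, sgn ((σ + fbit w .X) l.1) =
      (∏ l ∈ D.legs v, sgn (σ l.1)) * (-1) ^ (D.highlighted w v .X).card := fun σ => by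
    rw [← hc, ← Finset.prod_mul_distrib]
    exact Finset.prod_congr rfl fun l _ => by rw [← sgn_add]; rfl
  have hsq : ∀ σ : E → Fin 2, (∏ l ∈ D.legs v, sgn (σ l.1)) * (∏ l ∈ D.legs v, sgn (σ l.1)) = 1 :=
    fun σ => by
      rw [← Finset.prod_mul_distrib]
      exact Finset.prod_eq_one fun l _ => sgn_mul_self _
  simp only [tensor, hv, hprod, hshift]
  rcases D.neg_one_pow_phase h with ⟨hs, ho⟩ | ⟨hs, ho⟩
  · have hz := D.fbit_eq_zero_of_highlighted ho
    refine ⟨1, one_ne_zero, fun σ => ?_⟩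
    have e : ∏ l ∈ D.legs v, sgn (fbit w .Z l.1 * σ l.1) = 1 :=
      Finset.prod_eq_one fun l hl => by rw [hz l hl, zero_mul, sgn_zero]
    rw [e, hs]; ring
  · have hz := D.fbit_eq_one_of_highlighted ho
    refine ⟨Complex.I ^ (D.phase v).val * (-1) ^ (D.phase v).val,
      mul_ne_zero (pow_ne_zero _ Complex.I_ne_zero) (left_ne_zero_of_mul_eq_one hk), fun σ => ?_⟩
    have e : ∏ l ∈ D.legs v, sgn (fbit w .Z l.1 * σ l.1) = ∏ l ∈ D.legs v, sgn (σ l.1) :=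
      Finset.prod_congr rfl fun l hl => by rw [hz l hl, one_mul]
    rw [e, hs]
    linear_combination (Complex.I ^ (D.phase v).val * (-1) ^ (D.phase v).val *
        ∏ _l ∈ D.legs v, (1 / (√2 : ℂ))) * hsq σ -
      ((∏ l ∈ D.legs v, sgn (σ l.1)) * ∏ _l ∈ D.legs v, (1 / (√2 : ℂ))) *
        ((-1) ^ (D.phase v).val * hI + hk)

/-- The effect of a Pauli web on the tensor of a Hadamard node. -/
theorem tensor_H {w : Set (E × Colour)} {v : V} (hv : D.type v = .H)
    (h : D.HadamardRule w v) : ∃ ε : ℂ, ε ≠ 0 ∧ ∀ σ : E → Fin 2,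
      D.tensor (σ + fbit w .X) v * ∏ l ∈ D.legs v, sgn (fbit w .Z l.1 * σ l.1) =
        ε * D.tensor σ v := by
  classical
  have hcard := D.hadamard_degree v hv
  rw [← D.card_legs, Finset.card_eq_two] at hcard
  obtain ⟨l, l', hne, hlegs⟩ := hcard
  have hl : l ∈ D.legs v := by simp [hlegs]
  have hl' : l' ∈ D.legs v := by simp [hlegs]
  have e1 : fbit w .Z l.1 = fbit w .X l'.1 := by simp only [fbit, h l hl l' hl' hne]
  have e2 : fbit w .Z l'.1 = fbit w .X l.1 := by simp only [fbit, h l' hl' l hl hne.symm]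
  have ht : ∀ σ : E → Fin 2, D.tensor σ v = (1 / (√2 : ℂ)) * sgn (σ l.1 * σ l'.1) := by
    intro σ
    simp only [tensor, hv, hlegs, Finset.mem_insert, Finset.mem_singleton, forall_eq_or_imp,
      forall_eq]
    generalize σ l.1 = a
    generalize σ l'.1 = b
    fin_cases a <;> fin_cases b <;> simp
  refine ⟨sgn (fbit w .X l.1 * fbit w .X l'.1), sgn_ne_zero _, fun σ => ?_⟩
  rw [ht, ht, hlegs, Finset.prod_pair hne, e1, e2, mul_assoc, ← sgn_add, ← sgn_add,
    mul_left_comm, ← sgn_add, Pi.add_apply, Pi.add_apply]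
  congr 2
  generalize σ l.1 = a
  generalize σ l'.1 = b
  generalize fbit w .X l.1 = x
  generalize fbit w .X l'.1 = y
  revert a b x y
  decide

theorem exists_leg {v : V} (hv : D.type v = .B) : ∃ l, D.legs v = {l} := by
  rw [← Finset.card_eq_one, D.card_legs, D.boundary_degree v hv]

/-- The Pauli letter highlighted at a (boundary) node. -/
def letter (w : Set (E × Colour)) (v : V) : Pauli :=
  open Classical in
  pauliOfColours (D.highlighted w v .Z).Nonempty (D.highlighted w v .X).Nonempty

theorem out_apply (w : Set (E × Colour)) (j : Fin n) : D.out w j = D.letter w (D.output j) := rfl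

/-- The Pauli string given by the highlighted input edges. -/
def inp (w : Set (E × Colour)) : PauliString m := fun i => D.letter w (D.input i)

theorem letter_bits (w : Set (E × Colour)) {v : V} (hv : D.type v = .B) {l : E × Bool}
    (hl : l ∈ D.legs v) :
    (D.letter w v).zbit = fbit w .Z l.1 ∧ (D.letter w v).xbit = fbit w .X l.1 := by
  classical
  obtain ⟨l', hl'⟩ := D.exists_leg hv
  rw [hl', Finset.mem_singleton] at hl
  subst hl
  have key : ∀ c, (D.highlighted w v c).Nonempty ↔ (l.1, c) ∈ w := by
    intro c
    simp [Finset.Nonempty, D.mem_highlighted, hl']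
  simp only [letter, pauliOfColours, key, fbit]
  by_cases hz : (l.1, Colour.Z) ∈ w <;> by_cases hx : (l.1, Colour.X) ∈ w <;>
    simp [hz, hx, Pauli.zbit, Pauli.xbit]

theorem type_input (i : Fin m) : D.type (D.input i) = .B := (D.boundary (Sum.inl i)).2

theorem type_output (j : Fin n) : D.type (D.output j) = .B := (D.boundary (Sum.inr j)).2

@[to_additive]
theorem prod_boundary {M : Type*} [CommMonoid M] (f : V → M)
    (hf : ∀ v, D.type v ≠ .B → f v = 1) :
    ∏ v, f v = (∏ i, f (D.input i)) * ∏ j, f (D.output j) := by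
  classical
  rw [← Finset.prod_filter_of_ne (p := fun v => D.type v = .B)
    (fun v _ hv => by by_contra h; exact hv (hf v h)),
    Finset.prod_subtype (p := fun v => D.type v = .B) _ (by simp),
    ← D.boundary.prod_comp, Fintype.prod_sum_type]
  rfl

@[to_additive]
theorem prod_legs {M : Type*} [CommMonoid M] (f : E × Bool → M) :
    ∏ v, ∏ l ∈ D.legs v, f l = ∏ l, f l := by
  classical
  rw [← Finset.prod_fiberwise (s := Finset.univ) (g := D.ends)]
  exact Finset.prod_congr rfl fun v _ => Finset.prod_congr (by ext; simp [legs]) fun _ _ => rfl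

/-- A Pauli web maps the interpretation of the diagram to a multiple of itself. -/
theorem interp_shift {w : Set (E × Colour)} (hw : D.IsPauliWeb w) :
    ∃ ε : ℂ, ε ≠ 0 ∧ ∀ y x, D.interp (y + fun j => (D.out w j).xbit)
        (x + fun i => (D.inp w i).xbit) =
      ε * ((∏ i, sgn ((D.inp w i).zbit * x i)) * ∏ j, sgn ((D.out w j).zbit * y j)) *
        D.interp y x := by
  classical
  have hlocal : ∀ v, ∃ ε : ℂ, ε ≠ 0 ∧ ∀ σ : E → Fin 2,
      D.tensor (σ + fbit w .X) v * ∏ l ∈ D.legs v, sgn (fbit w .Z l.1 * σ l.1) =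
        ε * D.tensor σ v *
          if D.type v = .B then ∏ l ∈ D.legs v, sgn (fbit w .Z l.1 * σ l.1) else 1 := by
    intro v
    have hwv := hw v
    cases hv : D.type v <;> rw [hv] at hwv
    · simpa using D.tensor_Z hv hwv
    · simpa using D.tensor_X hv hwv
    · simpa using D.tensor_H hv hwv
    · exact ⟨1, one_ne_zero, fun σ => by simp [tensor, hv]⟩
  choose ε hε hT using hlocal
  refine ⟨∏ v, ε v, Finset.prod_ne_zero_iff.2 fun v _ => hε v, fun y x => ?_⟩
  have hcond : ∀ {v : V}, D.type v = .B → ∀ (σ : E → Fin 2) (a : Fin 2),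
      (∀ l ∈ D.legs v, (σ + fbit w .X) l.1 = a + (D.letter w v).xbit) ↔
        ∀ l ∈ D.legs v, σ l.1 = a := fun hv σ a => forall₂_congr fun l hl => by
    rw [(D.letter_bits w hv hl).2, Pi.add_apply, add_left_inj]
  have hsign : ∀ {v : V}, D.type v = .B → ∀ (σ : E → Fin 2) (a : Fin 2),
      (∀ l ∈ D.legs v, σ l.1 = a) → ∏ l ∈ D.legs v, sgn (fbit w .Z l.1 * σ l.1) =
        sgn ((D.letter w v).zbit * a) := by
    intro v hv σ a h
    obtain ⟨l, hl⟩ := D.exists_leg hv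
    have hm : l ∈ D.legs v := by simp [hl]
    rw [hl, Finset.prod_singleton, h l hm, (D.letter_bits w hv hm).1]
  unfold interp
  rw [← Equiv.sum_comp (Equiv.addRight (fbit w .X)), Finset.mul_sum]
  refine Finset.sum_congr rfl fun σ _ => ?_
  simp only [Equiv.coe_addRight]
  have e1 : ((∀ i, ∀ l ∈ D.legs (D.input i), (σ + fbit w .X) l.1 =
        (x + fun i => (D.inp w i).xbit) i) ∧
      ∀ j, ∀ l ∈ D.legs (D.output j), (σ + fbit w .X) l.1 =
        (y + fun j => (D.out w j).xbit) j) ↔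
      ((∀ i, ∀ l ∈ D.legs (D.input i), σ l.1 = x i) ∧
        ∀ j, ∀ l ∈ D.legs (D.output j), σ l.1 = y j) :=
    and_congr (forall_congr' fun i => hcond (D.type_input i) σ (x i))
      (forall_congr' fun j => hcond (D.type_output j) σ (y j))
  simp only [e1]
  split_ifs with hb
  · have hall : ∏ v, ∏ l ∈ D.legs v, sgn (fbit w .Z l.1 * σ l.1) = 1 := by
      rw [D.prod_legs fun l => sgn (fbit w .Z l.1 * σ l.1), Fintype.prod_prod_type]
      exact Finset.prod_eq_one fun e _ => by rw [Fintype.prod_bool, sgn_mul_self]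
    have hB : ∏ v, (if D.type v = .B then ∏ l ∈ D.legs v, sgn (fbit w .Z l.1 * σ l.1) else 1) =
        (∏ i, sgn ((D.inp w i).zbit * x i)) * ∏ j, sgn ((D.out w j).zbit * y j) := by
      rw [D.prod_boundary _ fun v hv => if_neg hv]
      congr 1
      · exact Finset.prod_congr rfl fun i _ => by
          rw [if_pos (D.type_input i), hsign (D.type_input i) σ _ (hb.1 i)]; rfl
      · exact Finset.prod_congr rfl fun j _ => by
          rw [if_pos (D.type_output j), hsign (D.type_output j) σ _ (hb.2 j)]; rfl
    have := Finset.prod_congr rfl fun v (_ : v ∈ Finset.univ) => hT v σ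
    simp only [Finset.prod_mul_distrib] at this
    rw [hall, hB, mul_one] at this
    rw [this]; ring
  · rw [mul_zero]

theorem exists_pauliMatrix_mul_interp {w : Set (E × Colour)} (hw : D.IsPauliWeb w) :
    ∃ c : ℂ, c ≠ 0 ∧
      pauliMatrix (D.out w) * D.interp * pauliMatrix (D.inp w) = c • D.interp := by
  obtain ⟨ε, hε, h⟩ := D.interp_shift hw
  exact pauliMatrix_mul_mul_pauliMatrix _ _ _ ε hε h

end ZXDiagram

/-- The exponent of `Z` or `X` in a Pauli letter, as an element of `ZMod 2`. -/
def Pauli.bit : Pauli → Colour → ZMod 2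
  | .I, _ => 0
  | .X, .Z => 0
  | .X, .X => 1
  | .Y, _ => 1
  | .Z, .Z => 1
  | .Z, .X => 0

theorem Pauli.ext_bit {a b : Pauli} (h : ∀ c, a.bit c = b.bit c) : a = b := by
  have hz := h .Z
  have hx := h .X
  cases a <;> cases b <;> simp_all [Pauli.bit]

theorem Pauli.exists_bit (f : Colour → ZMod 2) : ∃ a : Pauli, ∀ c, a.bit c = f c := by
  have key : ∀ z x : ZMod 2, ∃ a : Pauli, a.bit .Z = z ∧ a.bit .X = x := by
    intro z x
    fin_cases z <;> fin_cases x
    · exact ⟨.I, rfl, rfl⟩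
    · exact ⟨.X, rfl, rfl⟩
    · exact ⟨.Z, rfl, rfl⟩
    · exact ⟨.Y, rfl, rfl⟩
  obtain ⟨a, hz, hx⟩ := key (f .Z) (f .X)
  exact ⟨a, fun c => by cases c <;> assumption⟩

/-- The sign of an element of `ZMod 2`. -/
def zsgn (a : ZMod 2) : ℂ := if a = 0 then 1 else -1

@[simp] theorem zsgn_zero : zsgn 0 = 1 := if_pos rfl

@[simp] theorem zsgn_one : zsgn 1 = -1 := if_neg one_ne_zero

theorem zsgn_add (a b : ZMod 2) : zsgn (a + b) = zsgn a * zsgn b := by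
  have h : ∀ a : ZMod 2, a = 0 ∨ a = 1 := by decide
  have h2 : (1 + 1 : ZMod 2) = 0 := by decide
  rcases h a with rfl | rfl <;> rcases h b with rfl | rfl <;> simp [h2]

theorem zsgn_eq_one {a : ZMod 2} : zsgn a = 1 ↔ a = 0 := by
  have h : ∀ a : ZMod 2, a = 0 ∨ a = 1 := by decide
  rcases h a with rfl | rfl <;> norm_num

theorem zsgn_sum {ι : Type*} (s : Finset ι) (f : ι → ZMod 2) :
    zsgn (∑ i ∈ s, f i) = ∏ i ∈ s, zsgn (f i) := by
  classical
  induction s using Finset.induction_on with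
  | empty => simp
  | insert i s hi ih => rw [Finset.sum_insert hi, Finset.prod_insert hi, zsgn_add, ih]

/-- The symplectic form on Pauli strings. -/
def symp {n : ℕ} (P Q : PauliString n) : ZMod 2 := ∑ i, ∑ c, (P i).bit c * (Q i).bit c.opp

theorem symp_comm {n : ℕ} (P Q : PauliString n) : symp P Q = symp Q P := by
  refine Finset.sum_congr rfl fun i _ => ?_
  simp only [sum_colour, Colour.opp]
  ring

theorem Pauli.toMatrix_mul_comm (a b : Pauli) : a.toMatrix * b.toMatrix =
    zsgn (∑ c, a.bit c * b.bit c.opp) • (b.toMatrix * a.toMatrix) := by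
  have h2 : (1 + 1 : ZMod 2) = 0 := by decide
  rw [sum_colour]
  cases a <;> cases b <;> simp [Colour.opp, Pauli.bit, Pauli.toMatrix, h2]

theorem pauliMatrix_mul_comm {n : ℕ} (P Q : PauliString n) :
    pauliMatrix P * pauliMatrix Q = zsgn (symp P Q) • (pauliMatrix Q * pauliMatrix P) := by
  ext y x
  rw [Matrix.smul_apply, pauliMatrix_mul_apply, pauliMatrix_mul_apply, symp, zsgn_sum, smul_eq_mul,
    ← Finset.prod_mul_distrib]
  refine Finset.prod_congr rfl fun i _ => ?_
  rw [Pauli.toMatrix_mul_comm, Matrix.smul_apply, smul_eq_mul]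

theorem pauliMatrix_mul_ne_zero {n : ℕ} (P Q : PauliString n) :
    pauliMatrix P * pauliMatrix Q ≠ 0 := by
  intro h
  have : pauliMatrix P * (pauliMatrix P * pauliMatrix Q) * pauliMatrix Q = 1 := by
    rw [← mul_assoc, pauliMatrix_sq, one_mul, pauliMatrix_sq]
  rw [h, mul_zero, zero_mul] at this
  exact zero_ne_one this

theorem smul_left_cancel_matrix {ι κ : Type*} {a b : ℂ} {M : Matrix ι κ ℂ} (hM : M ≠ 0)
    (h : a • M = b • M) : a = b := by
  by_contra hab
  rw [← sub_eq_zero, ← sub_smul] at h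
  exact (smul_eq_zero.1 h).elim (fun h' => hab (sub_eq_zero.1 h')) hM

theorem pauliString_eq_of_smul {n : ℕ} {P Q : PauliString n} {c : ℂ}
    (h : pauliMatrix P = c • pauliMatrix Q) : P = Q := by
  have hc : c ≠ 0 := by
    rintro rfl
    have := pauliMatrix_mul_ne_zero P P
    rw [h, zero_smul, zero_mul] at this
    exact this rfl
  have hs : ∀ R, symp P R = symp Q R := by
    intro R
    have h1 := pauliMatrix_mul_comm P R
    rw [h, Matrix.smul_mul, Matrix.mul_smul, pauliMatrix_mul_comm Q R, smul_comm] at h1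
    have h2 := smul_left_cancel_matrix (pauliMatrix_mul_ne_zero R Q)
      (smul_right_injective _ hc ((smul_comm _ _ _).trans (h1.trans (smul_comm _ _ _)) :))
    have h3 : zsgn (symp P R + symp Q R) = 1 := by
      rw [zsgn_add, ← h2, ← zsgn_add, zsgn_eq_one]
      exact zmod_two_add_eq_zero.2 rfl
    exact zmod_two_add_eq_zero.1 (zsgn_eq_one.1 h3)
  funext i
  refine Pauli.ext_bit fun c => ?_
  obtain ⟨r, hr⟩ := Pauli.exists_bit fun c' => if c' = c.opp then 1 else 0
  have key : ∀ S : PauliString n, symp S (fun j => if j = i then r else .I) = (S i).bit c := by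
    intro S
    rw [symp, Finset.sum_eq_single i]
    · simp only [if_true, hr, sum_colour]
      cases c <;> simp [Colour.opp]
    · intro j _ hj
      simp [hj, Pauli.bit]
    · simp
  rw [← key P, ← key Q, hs]

theorem Pauli.toMatrix_mul_of_bit {a b c : Pauli} (h : ∀ k, c.bit k = a.bit k + b.bit k) :
    ∃ k : ℕ, a.toMatrix * b.toMatrix = Complex.I ^ k • c.toMatrix := by
  have h2 : (1 + 1 : ZMod 2) = 0 := by decide
  have hz := h .Z
  have hx := h .X
  clear h
  cases a <;> cases b <;> cases c <;> simp [Pauli.bit, h2] at hz hx <;>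
  first
  | (refine ⟨0, ?_⟩; simp [Pauli.toMatrix, Matrix.one_fin_two]; done)
  | (refine ⟨1, ?_⟩; simp [Pauli.toMatrix]; done)
  | (refine ⟨3, ?_⟩; simp [Pauli.toMatrix, Complex.I_pow_three])

theorem pauliMatrix_mul_of_bit {n : ℕ} {P Q R : PauliString n}
    (h : ∀ i k, (R i).bit k = (P i).bit k + (Q i).bit k) :
    ∃ k : ℕ, pauliMatrix P * pauliMatrix Q = Complex.I ^ k • pauliMatrix R := by
  choose k hk using fun i => Pauli.toMatrix_mul_of_bit (h i)
  refine ⟨∑ i, k i, ?_⟩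
  ext y x
  rw [pauliMatrix_mul_apply]
  simp [hk, pauliMatrix, Finset.prod_mul_distrib, Finset.prod_pow_eq_pow_sum]

instance phaseGroup_normal (n : ℕ) : (phaseGroup n).Normal where
  conj_mem := by
    rintro U ⟨k, hU⟩ V
    refine ⟨k, ?_⟩
    rw [Submonoid.coe_mul, Submonoid.coe_mul, hU, Matrix.mul_smul, mul_one, Matrix.smul_mul,
      ← Submonoid.coe_mul, mul_inv_cancel]
    rfl

theorem coe_pauliUnitary {n : ℕ} (P : PauliString n) :
    (pauliUnitary P : Matrix (Fin n → Fin 2) (Fin n → Fin 2) ℂ) = pauliMatrix P := rfl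

theorem pauliUnitary_mem {n : ℕ} (P : PauliString n) : pauliUnitary P ∈ pauliGroup n :=
  ⟨0, P, by simp [coe_pauliUnitary]⟩

theorem pauliUnitary_inv {n : ℕ} (P : PauliString n) : (pauliUnitary P)⁻¹ = pauliUnitary P := by
  refine inv_eq_of_mul_eq_one_left (Subtype.ext ?_)
  rw [Submonoid.coe_mul, coe_pauliUnitary, pauliMatrix_sq]
  rfl

section Stabiliser

variable {n : ℕ} {M : Matrix (Fin n → Fin 2) (Fin n → Fin 2) ℂ}

theorem stabiliser_eq_of_smul (hM : M ≠ 0) {s s' : QubitUnitary n}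
    (hs : s ∈ stabiliserGroup M) (hs' : s' ∈ stabiliserGroup M) {c : ℂ}
    (h : (s' : Matrix (Fin n → Fin 2) (Fin n → Fin 2) ℂ) = c • s.1) : s' = s ∧ c = 1 := by
  have h1 := hs'.2
  rw [h, Matrix.smul_mul, hs.2] at h1
  have hc : c = 1 := smul_left_cancel_matrix hM (h1.trans (one_smul ℂ M).symm)
  exact ⟨Subtype.ext (by rw [h, hc, one_smul]), hc⟩

theorem exists_sign_of_mem_stabiliser (hM : M ≠ 0) {s : QubitUnitary n}
    (hs : s ∈ stabiliserGroup M) : ∃ (P : PauliString n) (ε : ℂ), ε * ε = 1 ∧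
      (s : Matrix (Fin n → Fin 2) (Fin n → Fin 2) ℂ) = ε • pauliMatrix P := by
  obtain ⟨⟨k, P, hP⟩, h⟩ := hs
  refine ⟨P, Complex.I ^ k, ?_, hP⟩
  refine smul_left_cancel_matrix hM ?_
  have h2 : s.1 * (s.1 * M) = M := by rw [h, h]
  rw [← Matrix.mul_assoc, hP, Matrix.smul_mul, Matrix.mul_smul, pauliMatrix_sq, smul_smul,
    Matrix.smul_mul, Matrix.one_mul] at h2
  rw [h2, one_smul]

theorem mem_pauliNormalizer_of_symp (hM : M ≠ 0) {P : PauliString n}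
    (h : ∀ Q : PauliString n, ∀ δ : ℂ, δ ≠ 0 → pauliMatrix Q * M = δ • M → symp P Q = 0) :
    pauliUnitary P ∈ pauliNormalizer (stabiliserGroup M) := by
  refine ⟨Subgroup.centralizer_le_normalizer _ (?_ : _ ∈ Subgroup.centralizer _),
    pauliUnitary_mem P⟩
  rw [Subgroup.mem_centralizer_iff]
  intro s hs
  obtain ⟨Q, ε, hε, hQ⟩ := exists_sign_of_mem_stabiliser hM hs
  have h1 : pauliMatrix Q * M = ε • M := by
    have := congrArg (ε • ·) hs.2
    simp only [hQ, Matrix.smul_mul, smul_smul, hε, one_smul] at this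
    exact this
  refine Subtype.ext ?_
  rw [Submonoid.coe_mul, Submonoid.coe_mul, hQ, coe_pauliUnitary, Matrix.smul_mul, Matrix.mul_smul,
    pauliMatrix_mul_comm P, h Q ε (left_ne_zero_of_mul_eq_one hε) h1, zsgn_zero, one_smul]

theorem symp_eq_zero_of_mem_pauliNormalizer (hM : M ≠ 0) {U s : QubitUnitary n}
    {P Q : PauliString n} {c ε : ℂ} (hU : U ∈ pauliNormalizer (stabiliserGroup M))
    (hs : s ∈ stabiliserGroup M) (hUP : U.1 = c • pauliMatrix P) (hsQ : s.1 = ε • pauliMatrix Q) :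
    symp P Q = 0 := by
  have hc := (Subgroup.mem_normalizer_iff.1 hU.1 s).1 hs
  rw [← zsgn_eq_one]
  refine (stabiliser_eq_of_smul hM hs hc ?_).2
  have h1 : (U * s).1 = zsgn (symp P Q) • (s * U).1 := by
    rw [Submonoid.coe_mul, Submonoid.coe_mul, hUP, hsQ, Matrix.smul_mul, Matrix.mul_smul,
      Matrix.smul_mul, Matrix.mul_smul, pauliMatrix_mul_comm, smul_smul, smul_smul, smul_smul,
      smul_smul]
    congr 1
    ring
  rw [Submonoid.coe_mul, h1, Matrix.smul_mul, ← Submonoid.coe_mul, mul_inv_cancel_right]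

end Stabiliser

theorem bit_symmDiff {α : Type*} (w w' : Set α) (p : α) : bit (w ∆ w') p = bit w p + bit w' p := by
  have h2 : (1 + 1 : ZMod 2) = 0 := by decide
  by_cases h : p ∈ w <;> by_cases h' : p ∈ w' <;> simp [bit, Set.mem_symmDiff, h, h', h2]

theorem quotientClasses_eq {α : Type*} {N : Set (Set α)} (hN : ∀ a ∈ N, ∀ b ∈ N, a ∆ b ∈ N)
    {g g' : Set α} (h : g ∆ g' ∈ N) :
    {w | ∃ n ∈ N, w = g ∆ n} = {w | ∃ n ∈ N, w = g' ∆ n} := by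
  ext w
  constructor
  · rintro ⟨a, ha, rfl⟩
    refine ⟨(g ∆ g') ∆ a, hN _ h _ ha, ?_⟩
    rw [symmDiff_comm g g', ← symmDiff_assoc, ← symmDiff_assoc, symmDiff_self, bot_symmDiff]
  · rintro ⟨a, ha, rfl⟩
    refine ⟨(g ∆ g') ∆ a, hN _ h _ ha, ?_⟩
    rw [← symmDiff_assoc, ← symmDiff_assoc, symmDiff_self, bot_symmDiff]

namespace ZXDiagram

section General

variable {V E : Type*} [Fintype V] [Fintype E] {m n : ℕ} (D : ZXDiagram V E m n)

theorem letter_bit (w : Set (E × Colour)) {v : V} (hv : D.type v = .B) {l : E × Bool}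
    (hl : l ∈ D.legs v) (c : Colour) : (D.letter w v).bit c = bit w (l.1, c) := by
  classical
  obtain ⟨l', hl'⟩ := D.exists_leg hv
  rw [hl', Finset.mem_singleton] at hl
  subst hl
  have key : ∀ c, (D.highlighted w v c).Nonempty ↔ (l.1, c) ∈ w := by
    intro c
    simp [Finset.Nonempty, D.mem_highlighted, hl']
  simp only [letter, pauliOfColours, key]
  by_cases hz : (l.1, Colour.Z) ∈ w <;> by_cases hx : (l.1, Colour.X) ∈ w <;>
    cases c <;> simp [hz, hx, Pauli.bit, bit]

theorem avoids_iff (w : Set (E × Colour)) {v : V} (hv : D.type v = .B) :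
    D.Avoids w v ↔ ∀ c, (D.letter w v).bit c = 0 := by
  obtain ⟨l, hl⟩ := D.exists_leg hv
  have hm : l ∈ D.legs v := by simp [hl]
  refine forall_congr' fun c => ?_
  rw [D.letter_bit w hv hm, bit_eq_zero, Finset.eq_empty_iff_forall_notMem]
  simp [D.mem_highlighted, hl]

theorem letter_symmDiff (w w' : Set (E × Colour)) {v : V} (hv : D.type v = .B) (c : Colour) :
    (D.letter (w ∆ w') v).bit c = (D.letter w v).bit c + (D.letter w' v).bit c := by
  obtain ⟨l, hl⟩ := D.exists_leg hv
  have hm : l ∈ D.legs v := by simp [hl]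
  simp only [D.letter_bit _ hv hm, bit_symmDiff]

theorem out_symmDiff (w w' : Set (E × Colour)) (j : Fin n) (c : Colour) :
    (D.out (w ∆ w') j).bit c = (D.out w j).bit c + (D.out w' j).bit c :=
  D.letter_symmDiff w w' (D.type_output j) c

theorem avoids_outputs_iff (w : Set (E × Colour)) :
    (∀ j, D.Avoids w (D.output j)) ↔ ∀ j c, (D.out w j).bit c = 0 :=
  forall_congr' fun j => D.avoids_iff w (D.type_output j)

theorem out_symmDiff_of_avoids (w : Set (E × Colour)) {d : Set (E × Colour)}
    (hd : ∀ j, D.Avoids d (D.output j)) : D.out (w ∆ d) = D.out w := by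
  funext j
  refine Pauli.ext_bit fun c => ?_
  rw [out_symmDiff, (D.avoids_outputs_iff d).1 hd, add_zero]

theorem inp_eq_one {w : Set (E × Colour)} (h : ∀ i, D.Avoids w (D.input i)) :
    D.inp w = fun _ => .I :=
  funext fun i => Pauli.ext_bit fun c => (D.avoids_iff w (D.type_input i)).1 (h i) c

theorem output_injective : Function.Injective D.output := fun i j h => by
  simpa using D.boundary.injective (Subtype.ext h)

theorem input_ne_output (i : Fin m) (j : Fin n) : D.input i ≠ D.output j := fun h => by
  simpa using D.boundary.injective (Subtype.ext h)

/-- A Pauli string that commutes with the outputs of all webs avoiding `K` is the output of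
a web that avoids the inputs outside `K`. -/
theorem exists_web_out (K : Set V) (hK : ∀ j, D.output j ∉ K) (P : PauliString n)
    (h : ∀ w, D.IsPauliWeb w → (∀ v ∈ K, D.type v = .B → D.Avoids w v) → symp P (D.out w) = 0) :
    ∃ w, D.IsPauliWeb w ∧ D.out w = P ∧ ∀ i, D.input i ∉ K → D.Avoids w (D.input i) := by
  classical
  let τ : V → Pauli := fun v => if hv : ∃ j, D.output j = v then P hv.choose else .I
  have hτ_out : ∀ j, τ (D.output j) = P j := by
    intro j
    have hv : ∃ j', D.output j' = D.output j := ⟨j, rfl⟩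
    simp only [τ, dif_pos hv]
    rw [D.output_injective hv.choose_spec]
  have hτ : ∀ v, (∀ j, D.output j ≠ v) → τ v = .I := fun v hv =>
    dif_neg fun ⟨j, hj⟩ => hv j hj
  have hsupp : ∀ (l : E × Bool) (c : Colour), (τ (D.ends l)).bit c ≠ 0 →
      D.type (D.ends l) = .B ∧ D.ends l ∉ K := by
    intro l c hne
    by_cases hv : ∃ j, D.output j = D.ends l
    · obtain ⟨j, hj⟩ := hv
      rw [← hj]
      exact ⟨D.type_output j, hK j⟩
    · refine absurd ?_ hne
      rw [hτ _ (not_exists.1 hv)]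
      rfl
  have horth : ∀ w, D.IsPauliWeb w → (∀ v ∈ K, D.type v = .B → D.Avoids w v) →
      ∑ l, ∑ c, (τ (D.ends l)).bit c * bit w (l.1, c.opp) = 0 := by
    intro w hw hav
    rw [← h w hw hav, ← D.sum_legs, D.sum_boundary, Finset.sum_eq_zero, zero_add]
    · refine Finset.sum_congr rfl fun j _ => ?_
      obtain ⟨l, hl⟩ := D.exists_leg (D.type_output j)
      have hm : l ∈ D.legs (D.output j) := by simp [hl]
      rw [hl, Finset.sum_singleton]
      refine Finset.sum_congr rfl fun c _ => ?_
      rw [D.mem_legs.1 hm, hτ_out, out_apply, D.letter_bit w (D.type_output j) hm]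
    · intro i _
      refine Finset.sum_eq_zero fun l hl => Finset.sum_eq_zero fun c _ => ?_
      rw [D.mem_legs.1 hl, hτ _ fun j => (D.input_ne_output i j).symm]
      exact zero_mul _
    · intro v hv
      refine Finset.sum_eq_zero fun l hl => Finset.sum_eq_zero fun c _ => ?_
      rw [D.mem_legs.1 hl, hτ v fun j hj => hv (hj ▸ D.type_output j)]
      exact zero_mul _
  obtain ⟨w, hw, hbit⟩ := D.exists_web K (fun p => (τ (D.ends p.1)).bit p.2) hsupp horth
  have key : ∀ v, D.type v = .B → v ∉ K → D.letter w v = τ v := by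
    intro v hv hvK
    obtain ⟨l, hl⟩ := D.exists_leg hv
    have hm : l ∈ D.legs v := by simp [hl]
    refine Pauli.ext_bit fun c => ?_
    have he := D.mem_legs.1 hm
    rw [D.letter_bit w hv hm, hbit l (by rw [he, hv]) (by rw [he]; exact hvK), he]
  refine ⟨w, hw, funext fun j => ?_, fun i hi => ?_⟩
  · rw [out_apply, key _ (D.type_output j) (hK j), hτ_out]
  · rw [D.avoids_iff w (D.type_input i), key _ (D.type_input i) hi,
      hτ _ fun j => (D.input_ne_output i j).symm]
    exact fun _ => rfl

theorem detectingRegions_symmDiff :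
    ∀ a ∈ D.detectingRegions, ∀ b ∈ D.detectingRegions, a ∆ b ∈ D.detectingRegions :=
  fun _ ha _ hb => ⟨IsPauliWeb.symmDiff D ha.1 hb.1,
    fun i => Avoids.symmDiff D (ha.2.1 i) (hb.2.1 i),
    fun j => Avoids.symmDiff D (ha.2.2 j) (hb.2.2 j)⟩

theorem trivialWebs_symmDiff :
    ∀ a ∈ D.trivialWebs, ∀ b ∈ D.trivialWebs, a ∆ b ∈ D.trivialWebs := by
  rintro _ ⟨s, hs, c, hc, rfl⟩ _ ⟨s', hs', c', hc', rfl⟩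
  exact ⟨s ∆ s', ⟨IsPauliWeb.symmDiff D hs.1 hs'.1, fun i => Avoids.symmDiff D (hs.2 i) (hs'.2 i)⟩,
    c ∆ c', ⟨IsPauliWeb.symmDiff D hc.1 hc'.1, fun i => Avoids.symmDiff D (hc.2 i) (hc'.2 i)⟩,
    symmDiff_symmDiff_symmDiff_comm _ _ _ _⟩

end General

section Square

variable {V E : Type*} [Fintype V] [Fintype E] {n : ℕ} {D : ZXDiagram V E n n}
  {M : Matrix (Fin n → Fin 2) (Fin n → Fin 2) ℂ}

theorem exists_sign_of_web (hM : M ≠ 0) (hD : D.Represents M) {w : Set (E × Colour)}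
    (hw : D.IsPauliWeb w) : ∃ ε : ℂ, ε * ε = 1 ∧
      pauliMatrix (D.out w) * M * pauliMatrix (D.inp w) = ε • M := by
  obtain ⟨c, hc, hDc⟩ := hD
  obtain ⟨ε, -, h⟩ := D.exists_pauliMatrix_mul_interp hw
  rw [hDc, Matrix.mul_smul, Matrix.smul_mul, smul_comm] at h
  replace h := smul_right_injective _ hc h
  refine ⟨ε, smul_left_cancel_matrix hM ?_, h⟩
  have h2 : pauliMatrix (D.out w) * (pauliMatrix (D.out w) * M * pauliMatrix (D.inp w)) *
      pauliMatrix (D.inp w) = M := by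
    rw [Matrix.mul_assoc, Matrix.mul_assoc, Matrix.mul_assoc, pauliMatrix_sq, ← Matrix.mul_assoc,
      ← Matrix.mul_assoc, pauliMatrix_sq, Matrix.one_mul, Matrix.mul_one]
  rw [h, Matrix.mul_smul, Matrix.smul_mul, h, smul_smul] at h2
  rw [h2, one_smul]

/-- The output of a web commutes with the Pauli strings that stabilise the map up to a scalar. -/
theorem symp_out_eq_zero (hM : M ≠ 0) (hD : D.Represents M) {w : Set (E × Colour)}
    (hw : D.IsPauliWeb w) {Q : PauliString n} {δ : ℂ} (hδ : δ ≠ 0)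
    (hQ : pauliMatrix Q * M = δ • M) : symp Q (D.out w) = 0 := by
  obtain ⟨ε, hε, h⟩ := exists_sign_of_web hM hD hw
  have h1 : pauliMatrix Q * (pauliMatrix (D.out w) * M * pauliMatrix (D.inp w)) =
      (zsgn (symp Q (D.out w)) * δ * ε) • M := by
    rw [← Matrix.mul_assoc, ← Matrix.mul_assoc, pauliMatrix_mul_comm, Matrix.smul_mul,
      Matrix.smul_mul, Matrix.mul_assoc (pauliMatrix (D.out w)), hQ, Matrix.mul_smul,
      Matrix.smul_mul, h, smul_smul, smul_smul, mul_assoc]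
  rw [h, Matrix.mul_smul, hQ, smul_smul] at h1
  have h2 := smul_left_cancel_matrix hM h1
  have h3 : ε * δ ≠ 0 := mul_ne_zero (left_ne_zero_of_mul_eq_one hε) hδ
  rw [← zsgn_eq_one]
  refine mul_right_cancel₀ h3 ?_
  linear_combination -h2

theorem pauliUnitary_out_mem (hM : M ≠ 0) (hD : D.Represents M) {w : Set (E × Colour)}
    (hw : D.IsPauliWeb w) : pauliUnitary (D.out w) ∈ pauliNormalizer (stabiliserGroup M) :=
  mem_pauliNormalizer_of_symp hM fun Q δ hδ hQ => by
    rw [symp_comm]; exact symp_out_eq_zero hM hD hw hδ hQ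

theorem exists_stabiliser_of_web (hM : M ≠ 0) (hD : D.Represents M) {w : Set (E × Colour)}
    (hw : w ∈ D.stabilisingWebs) : ∃ s ∈ stabiliserGroup M, ∃ ε : ℂ, (ε = 1 ∨ ε = -1) ∧
      (s : Matrix (Fin n → Fin 2) (Fin n → Fin 2) ℂ) = ε • pauliMatrix (D.out w) := by
  obtain ⟨ε, hε, h⟩ := exists_sign_of_web hM hD hw.1
  rw [D.inp_eq_one hw.2, pauliMatrix_one, Matrix.mul_one] at h
  have hU : ε • pauliMatrix (D.out w) ∈ Matrix.unitaryGroup (Fin n → Fin 2) ℂ := by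
    have hs : star ε = ε := by
      rcases mul_self_eq_one_iff.1 hε with rfl | rfl <;> simp
    rw [Matrix.mem_unitaryGroup_iff, star_smul, pauliMatrix_star, hs, Matrix.smul_mul,
      Matrix.mul_smul, pauliMatrix_sq, smul_smul, hε, one_smul]
  refine ⟨⟨_, hU⟩, ⟨?_, ?_⟩, ε, mul_self_eq_one_iff.1 hε, rfl⟩
  · rcases mul_self_eq_one_iff.1 hε with rfl | rfl
    · exact ⟨0, D.out w, by simp⟩
    · exact ⟨2, D.out w, by simp⟩
  · change ε • pauliMatrix (D.out w) * M = M
    rw [Matrix.smul_mul, h, smul_smul, hε, one_smul]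

theorem exists_stabilisingWeb (hM : M ≠ 0) (hD : D.Represents M) {s : QubitUnitary n}
    (hs : s ∈ stabiliserGroup M) : ∃ w ∈ D.stabilisingWebs, ∃ ε : ℂ,
      (s : Matrix (Fin n → Fin 2) (Fin n → Fin 2) ℂ) = ε • pauliMatrix (D.out w) := by
  obtain ⟨P, ε, hε, hP⟩ := exists_sign_of_mem_stabiliser hM hs
  have hPM : pauliMatrix P * M = ε • M := by
    have := congrArg (ε • ·) hs.2
    simp only [hP, Matrix.smul_mul, smul_smul, hε, one_smul] at this
    exact this
  obtain ⟨w, hw, hout, hin⟩ := D.exists_web_out ∅ (fun _ => id) P fun w hw _ =>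
    symp_out_eq_zero hM hD hw (left_ne_zero_of_mul_eq_one hε) hPM
  exact ⟨w, ⟨hw, fun i => hin i id⟩, ε, by rw [hP, hout]⟩

theorem exists_web_of_mem_pauliNormalizer (hM : M ≠ 0) (hD : D.Represents M) {U : QubitUnitary n}
    (hU : U ∈ pauliNormalizer (stabiliserGroup M)) : ∃ w ∈ D.pauliWebs, ∃ k : ℕ,
      (U : Matrix (Fin n → Fin 2) (Fin n → Fin 2) ℂ) =
        Complex.I ^ k • pauliMatrix (D.out w) := by
  obtain ⟨k, P, hP⟩ := hU.2
  obtain ⟨w, hw, hout, -⟩ := D.exists_web_out (Set.range D.input)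
    (fun j ⟨i, hi⟩ => D.input_ne_output i j hi) P fun w hw hav => by
      obtain ⟨s, hs, ε, -, hε⟩ := exists_stabiliser_of_web hM hD
        (w := w) ⟨hw, fun i => hav _ ⟨i, rfl⟩ (D.type_input i)⟩
      exact symp_eq_zero_of_mem_pauliNormalizer hM hU hs hP hε
  exact ⟨w, hw, k, by rw [hP, hout]⟩

theorem inv_mul_mem_sup_iff (hM : M ≠ 0) (hD : D.Represents M) (P Q : PauliString n) :
    (pauliUnitary P)⁻¹ * pauliUnitary Q ∈ stabiliserGroup M ⊔ phaseGroup n ↔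
      ∃ w ∈ D.stabilisingWebs, ∀ j c, (Q j).bit c = (P j).bit c + (D.out w j).bit c := by
  have h2 : ∀ a b c : ZMod 2, a = b + c ↔ c = b + a := by decide
  rw [pauliUnitary_inv, Subgroup.mem_sup_of_normal_right]
  constructor
  · rintro ⟨s, hs, z, ⟨k, hz⟩, h⟩
    obtain ⟨w, hw, ε, hε⟩ := exists_stabilisingWeb hM hD hs
    refine ⟨w, hw, fun j c => ?_⟩
    choose R hR using fun j => Pauli.exists_bit fun c => (P j).bit c + (Q j).bit c
    obtain ⟨l, hl⟩ := pauliMatrix_mul_of_bit hR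
    have hsz : (s * z).1 = (pauliUnitary P * pauliUnitary Q).1 := by rw [h]
    rw [Submonoid.coe_mul, Submonoid.coe_mul, coe_pauliUnitary, coe_pauliUnitary, hl, hε, hz,
      Matrix.mul_smul, Matrix.mul_one, smul_smul] at hsz
    have hRw : R = D.out w := by
      refine pauliString_eq_of_smul (c := (Complex.I ^ l)⁻¹ * (Complex.I ^ k * ε)) ?_
      rw [mul_smul, hsz, smul_smul, inv_mul_cancel₀ (pow_ne_zero _ Complex.I_ne_zero), one_smul]
    rw [← hRw, h2, hR]
  · rintro ⟨w, hw, h⟩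
    obtain ⟨s, hs, ε, hε, hsε⟩ := exists_stabiliser_of_web hM hD hw
    obtain ⟨k, hk⟩ := pauliMatrix_mul_of_bit (P := P) (Q := Q) (R := D.out w)
      fun j c => (h2 _ _ _).1 (h j c)
    refine ⟨s, hs, s⁻¹ * (pauliUnitary P * pauliUnitary Q), ?_, by rw [mul_inv_cancel_left]⟩
    have hss : s⁻¹ = s := by
      refine inv_eq_of_mul_eq_one_left (Subtype.ext ?_)
      rw [Submonoid.coe_mul, hsε, Matrix.smul_mul, Matrix.mul_smul, pauliMatrix_sq, smul_smul,
        mul_self_eq_one_iff.2 hε, one_smul]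
      rfl
    have hval : (s⁻¹ * (pauliUnitary P * pauliUnitary Q)).1 = (ε * Complex.I ^ k) • 1 := by
      rw [hss, Submonoid.coe_mul, Submonoid.coe_mul, coe_pauliUnitary, coe_pauliUnitary, hk, hsε,
        Matrix.smul_mul, Matrix.mul_smul, pauliMatrix_sq, smul_smul]
    rcases hε with rfl | rfl
    · exact ⟨k, by rw [hval, one_mul]⟩
    · exact ⟨2 + k, by rw [hval, pow_add, Complex.I_sq]⟩

theorem exists_bijection_stabilisers (hM : M ≠ 0) (hD : D.Represents M) :
    ∃ b : quotientClasses D.stabilisingWebs D.detectingRegions D.stabilisingWebs_symmDiff →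
        stabiliserGroup M,
      Function.Bijective b ∧
      ∀ A, ∀ w ∈ A.1,
        ((b A : QubitUnitary n) : Matrix (Fin n → Fin 2) (Fin n → Fin 2) ℂ) =
            pauliMatrix (D.out w) ∨
        ((b A : QubitUnitary n) : Matrix (Fin n → Fin 2) (Fin n → Fin 2) ℂ) =
            -pauliMatrix (D.out w) := by
  choose g hg hgA using fun A : quotientClasses D.stabilisingWebs D.detectingRegions
    D.stabilisingWebs_symmDiff => A.2
  choose s hs ε hε hsε using fun A => exists_stabiliser_of_web hM hD (hg A)
  have hout : ∀ A, ∀ w ∈ A.1, D.out w = D.out (g A) := by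
    intro A w hw
    rw [hgA A] at hw
    obtain ⟨d, hd, rfl⟩ := hw
    exact D.out_symmDiff_of_avoids _ hd.2.2
  have hself : ∀ x ∈ D.stabilisingWebs, x ∈ {w | ∃ d ∈ D.detectingRegions, w = x ∆ d} := by
    intro x hx
    have h0 : x ∆ x ∈ D.stabilisingWebs :=
      ⟨IsPauliWeb.symmDiff D hx.1 hx.1, fun i => Avoids.symmDiff D (hx.2 i) (hx.2 i)⟩
    refine ⟨x ∆ x, ⟨h0.1, h0.2, ?_⟩, by rw [symmDiff_self, symmDiff_bot]⟩
    rw [D.avoids_outputs_iff]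
    intro j c
    rw [out_symmDiff]
    exact zmod_two_add_eq_zero.2 rfl
  refine ⟨fun A => ⟨s A, hs A⟩, ⟨fun A A' h => ?_, fun u => ?_⟩, fun A w hw => ?_⟩
  · have hsA : s A = s A' := congrArg Subtype.val h
    have hne : ε A ≠ 0 := by
      rcases hε A with h | h <;> rw [h] <;> norm_num
    have ho : D.out (g A) = D.out (g A') := by
      refine pauliString_eq_of_smul (c := (ε A)⁻¹ * ε A') ?_
      rw [mul_smul, ← hsε A', ← hsA, hsε A, smul_smul, inv_mul_cancel₀ hne, one_smul]
    refine Subtype.ext ?_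
    rw [hgA A, hgA A']
    refine quotientClasses_eq D.detectingRegions_symmDiff
      ⟨IsPauliWeb.symmDiff D (hg A).1 (hg A').1,
        fun i => Avoids.symmDiff D ((hg A).2 i) ((hg A').2 i), ?_⟩
    rw [D.avoids_outputs_iff]
    intro j c
    rw [out_symmDiff, ho]
    exact zmod_two_add_eq_zero.2 rfl
  · obtain ⟨w, hw, δ, hδ⟩ := exists_stabilisingWeb hM hD u.2
    let A : quotientClasses D.stabilisingWebs D.detectingRegions D.stabilisingWebs_symmDiff :=
      ⟨_, w, hw, rfl⟩
    refine ⟨A, Subtype.ext ?_⟩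
    have ho := hout A w (hself w hw)
    refine (stabiliser_eq_of_smul hM u.2 (hs A) (c := ε A * δ⁻¹) ?_).1
    have hδ0 : δ ≠ 0 := by
      rintro rfl
      have h1 := u.2.2
      rw [hδ, zero_smul, Matrix.zero_mul] at h1
      exact hM h1.symm
    rw [hδ, ho, smul_smul, mul_assoc, inv_mul_cancel₀ hδ0, mul_one, hsε]
  · rw [hout A w hw, hsε A]
    rcases hε A with h | h <;> rw [h]
    · left; rw [one_smul]
    · right; rw [neg_smul, one_smul]

theorem exists_bijection_logicals (hM : M ≠ 0) (hD : D.Represents M) :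
    ∃ b : quotientClasses D.pauliWebs D.trivialWebs D.pauliWebs_symmDiff →
        Logicals (stabiliserGroup M),
      Function.Bijective b ∧
      ∀ A, ∀ w ∈ A.1,
        ∃ h : pauliUnitary (D.out w) ∈ pauliNormalizer (stabiliserGroup M),
          b A = QuotientGroup.mk ⟨pauliUnitary (D.out w), h⟩ := by
  choose g hg hgA using fun A : quotientClasses D.pauliWebs D.trivialWebs
    D.pauliWebs_symmDiff => A.2
  have hmem : ∀ w, D.IsPauliWeb w → pauliUnitary (D.out w) ∈ pauliNormalizer (stabiliserGroup M) :=
    fun w hw => pauliUnitary_out_mem hM hD hw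
  have hval : ∀ A, ∀ w ∈ A.1, ∃ h : pauliUnitary (D.out w) ∈ pauliNormalizer (stabiliserGroup M),
      (QuotientGroup.mk ⟨pauliUnitary (D.out (g A)), hmem _ (hg A)⟩ :
        Logicals (stabiliserGroup M)) = QuotientGroup.mk ⟨pauliUnitary (D.out w), h⟩ := by
    intro A w hw
    rw [hgA A] at hw
    obtain ⟨_, ⟨s, hs, c, hc, rfl⟩, rfl⟩ := hw
    refine ⟨hmem _ (IsPauliWeb.symmDiff D (hg A) (IsPauliWeb.symmDiff D hs.1 hc.1)), ?_⟩
    rw [QuotientGroup.eq, Subgroup.mem_subgroupOf]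
    refine (inv_mul_mem_sup_iff hM hD _ _).2 ⟨s, hs, fun j k => ?_⟩
    rw [out_symmDiff, out_symmDiff, (D.avoids_outputs_iff c).1 hc.2, add_zero]
  have hempty : (∅ : Set (E × Colour)) ∈ D.trivialWebs := by
    have h0 : D.IsPauliWeb ∅ ∧ ∀ v, D.Avoids (∅ : Set (E × Colour)) v := by
      have h1 := (D.mem_localSpace_iff Set.univ ∅).1 ?_
      · exact ⟨h1.1, fun v c => by simp [highlighted]⟩
      · convert (D.localSpace Set.univ).zero_mem
        ext p
        exact bit_eq_zero.2 (Set.notMem_empty _)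
    exact ⟨∅, ⟨h0.1, fun _ => h0.2 _⟩, ∅, ⟨h0.1, fun _ => h0.2 _⟩,
      (symmDiff_self (∅ : Set (E × Colour))).symm⟩
  refine ⟨fun A => QuotientGroup.mk ⟨pauliUnitary (D.out (g A)), hmem _ (hg A)⟩,
    ⟨fun A A' h => ?_, fun q => ?_⟩, hval⟩
  · replace h := QuotientGroup.eq.1 h
    rw [Subgroup.mem_subgroupOf] at h
    obtain ⟨s, hs, hb⟩ := (inv_mul_mem_sup_iff hM hD _ _).1 h
    refine Subtype.ext ?_
    rw [hgA A, hgA A']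
    refine quotientClasses_eq D.trivialWebs_symmDiff ⟨s, hs, s ∆ (g A ∆ g A'), ⟨?_, ?_⟩, ?_⟩
    · exact IsPauliWeb.symmDiff D hs.1 (IsPauliWeb.symmDiff D (hg A) (hg A'))
    · rw [D.avoids_outputs_iff]
      intro j c
      rw [out_symmDiff, out_symmDiff, hb]
      generalize (D.out s j).bit c = a
      generalize (D.out (g A) j).bit c = b
      revert a b
      decide
    · rw [symmDiff_symmDiff_cancel_left]
  · obtain ⟨U, rfl⟩ := QuotientGroup.mk_surjective q
    obtain ⟨w, hw, k, hk⟩ := exists_web_of_mem_pauliNormalizer hM hD U.2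
    let A : quotientClasses D.pauliWebs D.trivialWebs D.pauliWebs_symmDiff := ⟨_, w, hw, rfl⟩
    refine ⟨A, ?_⟩
    obtain ⟨h, hA⟩ := hval A w ⟨∅, hempty, (symmDiff_bot w).symm⟩
    refine hA.trans ?_
    rw [QuotientGroup.eq, Subgroup.mem_subgroupOf]
    refine Subgroup.mem_sup_right ⟨k, ?_⟩
    change ((pauliUnitary (D.out w))⁻¹ * U.1 : QubitUnitary n).1 = _
    rw [pauliUnitary_inv, Submonoid.coe_mul, hk, coe_pauliUnitary, Matrix.mul_smul, pauliMatrix_sq]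

end Square

end ZXDiagram
end FloquetWebs
end

theorem mainTheorem11 {V E : Type*} [Fintype V] [Fintype E] {n : ℕ}
    (F : FloquetCode n) (o : ℕ → Bool) (t : ℕ) (hC : F.circuit o t ≠ 0)
    (D : ZXDiagram V E n n) (hD : D.Represents (F.circuit o t)) :
    (∃ b : quotientClasses D.stabilisingWebs D.detectingRegions D.stabilisingWebs_symmDiff →
          F.instStabGroup o t,
        Function.Bijective b ∧
        ∀ A, ∀ w ∈ A.1,
          ((b A : QubitUnitary n) : Matrix (Fin n → Fin 2) (Fin n → Fin 2) ℂ) =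
              pauliMatrix (D.out w) ∨
          ((b A : QubitUnitary n) : Matrix (Fin n → Fin 2) (Fin n → Fin 2) ℂ) =
              -pauliMatrix (D.out w)) ∧
    (∃ b : quotientClasses D.pauliWebs D.trivialWebs D.pauliWebs_symmDiff →
          Logicals (F.instStabGroup o t),
        Function.Bijective b ∧
        ∀ A, ∀ w ∈ A.1,
          ∃ h : pauliUnitary (D.out w) ∈ pauliNormalizer (F.instStabGroup o t),
            b A = QuotientGroup.mk ⟨pauliUnitary (D.out w), h⟩) :=
  ⟨ZXDiagram.exists_bijection_stabilisers hC hD, ZXDiagram.exists_bijection_logicals hC hD⟩
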